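/- **Setting.** Let $n\ge 1$ and write $\bar i=-i$. A signed permutation of $[n]=\{1,\dots,n\}$ is a bijection $\pi$ of $\{\pm1,\dots,\pm n\}$ with $\pi(\bar i)=\overline{\pi(i)}$; products are compositions, and $\pi$ is written as the word $\pi_1\pi_2\cdots\pi_n$ with $\pi_i=\pi(i)$. Let $\mathcal D_n$ be the group of signed permutations with an even number of negative $\pi_i$, $1\le i\le n$. For $m\le n$ regard $\mathcal D_m$ as the subgroup of those elements of $\mathcal D_n$ that fix $m+1,\dots,n$. For $1\le |i|<j\le n$ let $t_{ij}=(i\,j)(\bar i\,\bar j)$, for $1<i\le n$ let $t_{\bar i i}=(\bar 1\,1)(\bar i\,i)$, and let $t_{ii}$ be the identity. * $\ell_D(\pi)$ is the minimal number of factors in an expression of $\pi$ as a product of elements of $\{t_{\bar 1 2},t_{12},t_{23},\dots,t_{n-1,n}\}$ (for $n=1$ this set is empty). * $\mathsf{sor}_D(\pi)=\sum_{r=1}^k\big(j_r-i_r-2\chi(i_r<0)\big)$, where $\pi=t_{i_1j_1}\cdots t_{i_kj_k}$ is the unique factorization with $1<j_1<\dots<j_k\le n$ and, for each $r$, $1\le|i_r|<j_r$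 or $i_r=\bar j_r$. Here $\chi$ is $1$ if the condition holds and $0$ otherwise. **Statistics.** All of the following are subsets of $[n]$. * $\mathsf{Rmil}_D^{+}(\pi)=\{1\}\cup\{|\pi_i| : \pi_i>0,\ |\pi_i|<|\pi_j|\text{ for all }j>i\}$ and $\mathsf{Rmil}_D^{-}(\pi)=\{|\pi_i| : \pi_i<0,\ |\pi_i|<|\pi_j|\text{ for all }j>i\}\setminus\{1\}$. * $\mathsf{Lmil}_D(\pi)=\{|\pi_i| : |\pi_i|<|\pi_j|\text{ for all }j<i\}$ and $\mathsf{Lmap}_D(\pi)=\{i : |\pi_i|>|\pi_j|\text{ for all }j<i\}$. * $\mathsf{Lmic}_D(\pi)$ is the set of the values $|\pi^k(1)|$, $k\ge1$, for which $|\pi^k(1)|<|\pi^j(1)|$ for all $1\le j<k$. * Consider the cycles of the unsigned permutation $|\pi_1|\cdots|\pi_n|$. Then $\mathsf{Cyc}_D^{+}(\pi)$ is the union of $\{1\}$ and the set of the smallest elements of those cycles $C$ for which the number of $i\in C$ with $\pi_i<0$ is even, and $\mathsf{Cyc}_D^{-}(\pi)$ is the set of the smallest elements of those cycles for which this number is odd,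 with $1$ removed. **Codes.** Let $\mathsf{SE}_n^D$ be the set of integer sequences $(c_1,\dots,c_n)$ with $c_1=1$ and $c_i\in[-i,i]\setminus\{0\}$ for $i\ge 2$. * *C-code.* Put $\pi^{(n)}=\pi$. For $i=n,n-1,\dots,2$: if the letter $i$ is at position $p$ of the word $\pi^{(i)}$, put $c_i=p$ and delete it to obtain $\pi^{(i-1)}$; if the letter $\bar i$ is at position $p$, put $c_i=-p$, delete it, and change the sign of the first remaining letter to obtain $\pi^{(i-1)}$. Finally $c_1=\pi^{(1)}(1)$. * *D-code.* Put $\pi^{(n)}=\pi$. For $i=n,n-1,\dots,2$: if the letter $i$ is at position $p$ of $\pi^{(i)}$, put $d_i=p$ and $\pi^{(i-1)}=\pi^{(i)}t_{p\,i}$; if the letter $\bar i$ is at position $p$, put $d_i=-p$ and $\pi^{(i-1)}=\pi^{(i)}t_{\bar p\,i}$. In both cases $\pi^{(i-1)}$ fixes $i$. Finally $d_1=\pi^{(1)}(1)$. **Theorem 6.1.** The group $\mathcal D_n$ is generated by $t_{\bar12},t_{12},\dots,t_{n-1,n}$, each of its elements has exactly one factorization as in the definition of $\mathsf{sor}_D$,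 and the C-code and the D-code are bijections from $\mathcal D_n$ onto $\mathsf{SE}_n^D$. Hence $\ell_D$, $\mathsf{sor}_D$ and the map $\psi=(\text{D-code})^{-1}\circ(\text{C-code})$ on $\mathcal D_n$ are well defined. For every $\pi\in\mathcal D_n$, $$(\ell_D,\mathsf{Rmil}_D^{+},\mathsf{Rmil}_D^{-},\mathsf{Lmil}_D,\mathsf{Lmap}_D)(\pi)=(\mathsf{sor}_D,\mathsf{Cyc}_D^{+},\mathsf{Cyc}_D^{-},\mathsf{Lmic}_D,\mathsf{Lmap}_D)(\psi(\pi)).$$ -/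

import Mathlib

/-!
Signed permutations are permutations `π` of `ℤ` with `π (-i) = -π i`. The letter `i` with one bar
is the integer `-i`, so a letter of color `0` is a positive integer, a letter of color `1` is a
negative integer, and the base value is the absolute value.
-/

namespace EvenSigned

/-- `π` is a signed permutation of `±1, …, ±n` (an element of the group of colored permutations
with two colors), extended to all of `ℤ` by the identity. -/
def IsSigned (n : ℕ) (π : Equiv.Perm ℤ) : Prop :=
  (∀ i, π (-i) = -π i) ∧ ∀ i, (n : ℤ) < |i| → π i = i

/-- The number of negative letters in the window `π 1, …, π n`. -/
noncomputable def negCount (n : ℕ) (π : Equiv.Perm ℤ) : ℕ :=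
  ((Finset.Icc (1 : ℤ) n).filter (fun i => π i < 0)).card

theorem IsSigned.mul {n : ℕ} {π τ : Equiv.Perm ℤ} (hπ : IsSigned n π) (hτ : IsSigned n τ) :
    IsSigned n (π * τ) :=
  ⟨fun i => by simp [hτ.1, hπ.1], fun i hi => by simp [hτ.2 i hi, hπ.2 i hi]⟩

theorem IsSigned.inv {n : ℕ} {π : Equiv.Perm ℤ} (hπ : IsSigned n π) : IsSigned n π⁻¹ := by
  refine ⟨fun i => ?_, fun i hi => ?_⟩
  · rw [Equiv.Perm.inv_eq_iff_eq, hπ.1]; simp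
  · rw [Equiv.Perm.inv_eq_iff_eq, hπ.2 i hi]

theorem IsSigned.ne_zero {n : ℕ} {π : Equiv.Perm ℤ} (hπ : IsSigned n π) {i : ℤ} (hi : i ≠ 0) :
    π i ≠ 0 := by
  intro h
  have h0 : π 0 = 0 := by have := hπ.1 0; simp at this; omega
  exact hi (π.injective (h.trans h0.symm))

theorem IsSigned.sign_mul {n : ℕ} {π : Equiv.Perm ℤ} (hπ : IsSigned n π) (x : ℤ) :
    (π x).sign = (π |x|).sign * x.sign := by
  rcases lt_trichotomy x 0 with h | h | h
  · rw [abs_of_neg h, hπ.1, Int.sign_eq_neg_one_of_neg h]; simp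
  · subst h
    have h0 : π 0 = 0 := by have := hπ.1 0; simp at this; omega
    simp [h0]
  · rw [abs_of_pos h, Int.sign_eq_one_of_pos h]; simp

theorem IsSigned.abs_mem {n : ℕ} {π : Equiv.Perm ℤ} (hπ : IsSigned n π) {i : ℤ}
    (hi : i ∈ Finset.Icc (1 : ℤ) n) : |π i| ∈ Finset.Icc (1 : ℤ) n := by
  rw [Finset.mem_Icc] at hi ⊢
  have h1 := hπ.ne_zero (i := i) (by omega)
  refine ⟨by have := abs_pos.2 h1; omega, ?_⟩
  by_contra! h
  have h2 := π.injective (hπ.2 _ h)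
  rw [h2, abs_of_pos (by omega)] at h
  omega

theorem IsSigned.prod_sign {n : ℕ} {π : Equiv.Perm ℤ} (hπ : IsSigned n π) :
    ∏ i ∈ Finset.Icc (1 : ℤ) n, (π i).sign = (-1) ^ negCount n π := by
  rw [negCount, ← Finset.prod_const, Finset.prod_filter]
  refine Finset.prod_congr rfl fun i hi => ?_
  have h1 := hπ.ne_zero (i := i) (by rw [Finset.mem_Icc] at hi; omega)
  split_ifs with h
  · exact Int.sign_eq_neg_one_of_neg h
  · exact Int.sign_eq_one_of_pos (by omega)

theorem IsSigned.negCount_mul {n : ℕ} {π τ : Equiv.Perm ℤ} (hπ : IsSigned n π)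
    (hτ : IsSigned n τ) :
    (-1 : ℤ) ^ negCount n (π * τ) = (-1) ^ negCount n π * (-1) ^ negCount n τ := by
  rw [← (hπ.mul hτ).prod_sign, ← hπ.prod_sign, ← hτ.prod_sign]
  have h1 : ∏ i ∈ Finset.Icc (1 : ℤ) n, (π |τ i|).sign
      = ∏ i ∈ Finset.Icc (1 : ℤ) n, (π i).sign := by
    refine Finset.prod_bij (fun i _ => |τ i|) (fun i hi => hτ.abs_mem hi) ?_ ?_ (fun _ _ => rfl)
    · intro a ha b hb h
      rw [Finset.mem_Icc] at ha hb
      rcases abs_eq_abs.1 h with h | h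
      · exact τ.injective h
      · rw [← hτ.1] at h
        have := τ.injective h
        omega
    · intro b hb
      refine ⟨|τ⁻¹ b|, hτ.inv.abs_mem hb, ?_⟩
      rw [Finset.mem_Icc] at hb
      rcases abs_choice (τ⁻¹ b) with h | h <;> rw [h]
      · simp; omega
      · rw [hτ.1]; simp; omega
  rw [← h1, ← Finset.prod_mul_distrib]
  exact Finset.prod_congr rfl fun i _ => by rw [Equiv.Perm.mul_apply, hπ.sign_mul]

/-- The group `D_n` of even-signed permutations. Elements of `D_m` with `m ≤ n` are identified
with the elements of `D_n` that fix `m + 1, …, n`. -/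
def D (n : ℕ) : Subgroup (Equiv.Perm ℤ) where
  carrier := {π | IsSigned n π ∧ Even (negCount n π)}
  one_mem' := by
    refine ⟨⟨fun i => rfl, fun i _ => rfl⟩, ?_⟩
    have : negCount n 1 = 0 := by
      rw [negCount, Finset.card_eq_zero, Finset.filter_eq_empty_iff]
      intro i hi
      rw [Finset.mem_Icc] at hi
      simp; omega
    simp [this]
  mul_mem' := by
    rintro π τ ⟨hπ, hπ'⟩ ⟨hτ, hτ'⟩
    refine ⟨hπ.mul hτ, ?_⟩
    rw [← neg_one_pow_eq_one_iff_even (R := ℤ) (by decide), hπ.negCount_mul hτ,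
      hπ'.neg_one_pow, hτ'.neg_one_pow, one_mul]
  inv_mem' := by
    rintro π ⟨hπ, hπ'⟩
    refine ⟨hπ.inv, ?_⟩
    have h := hπ.negCount_mul hπ.inv
    have h1 := IsSigned.prod_sign (n := n) (π := 1) ⟨fun i => rfl, fun i _ => rfl⟩
    rw [mul_inv_cancel, hπ'.neg_one_pow, one_mul, ← h1] at h
    rw [← neg_one_pow_eq_one_iff_even (R := ℤ) (by decide), ← h]
    refine Finset.prod_eq_one fun i hi => ?_
    rw [Finset.mem_Icc] at hi
    exact Int.sign_eq_one_of_pos (by simp; omega)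

/-! ### Length and sorting index -/

/-- The element `t_{ij}`: the signed transposition `(i j)` (which also exchanges `-i` and `-j`)
if `i ≠ ±j`, the product of the sign changes of `1` and of `j` if `i = -j`, and the identity
if `i = j`. -/
def t (i j : ℤ) : Equiv.Perm ℤ :=
  if i = j then 1
  else if i = -j then Equiv.swap (-1) 1 * Equiv.swap (-j) j
  else Equiv.swap i j * Equiv.swap (-i) (-j)

/-- The Coxeter generators of `D_n`: the signed transpositions `(-1 2)` and `(i i+1)`,
`1 ≤ i ≤ n - 1`. -/
def S (n : ℕ) : Set (Equiv.Perm ℤ) :=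
  {g | 2 ≤ n ∧ g = t (-1) 2} ∪ {g | ∃ i : ℤ, 1 ≤ i ∧ i + 1 ≤ n ∧ g = t i (i + 1)}

/-- The length function of `D_n` with respect to the generators `S n`. -/
noncomputable def len (n : ℕ) (π : Equiv.Perm ℤ) : ℕ :=
  sInf {k | ∃ L : List (Equiv.Perm ℤ), (∀ g ∈ L, g ∈ S n) ∧ L.length = k ∧ L.prod = π}

/-- The list `(i₁, j₁), …, (i_k, j_k)` is a factorization `π = t_{i₁j₁} ⋯ t_{i_kj_k}` with
`1 < j₁ < ⋯ < j_k ≤ n`, where each `i_r` is nonzero, and either `|i_r| < j_r` or `i_r = -j_r`. -/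
def IsFactorization (n : ℕ) (π : Equiv.Perm ℤ) (L : List (ℤ × ℤ)) : Prop :=
  (∀ p ∈ L, 1 < p.2 ∧ p.2 ≤ n ∧ p.1 ≠ 0 ∧ (|p.1| < p.2 ∨ p.1 = -p.2)) ∧
    (L.map Prod.snd).Pairwise (· < ·) ∧ (L.map (fun p => t p.1 p.2)).prod = π

open Classical in
/-- The sorting index: the sum of `j - i - 2χ(i < 0)` over the pairs `(i, j)` of the unique
factorization of `π` (and `0` for permutations without such a factorization). -/
noncomputable def sor (n : ℕ) (π : Equiv.Perm ℤ) : ℤ :=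
  if h : ∃ L, IsFactorization n π L then
    (h.choose.map (fun p => p.2 - p.1 - 2 * (if p.1 < 0 then 1 else 0))).sum
  else 0

/-! ### Set-valued statistics

Sets of colored letters or places are sets of nonzero integers, the color being the sign. -/

/-- Base values of the members of color `0`. -/
def color0 (A : Set ℤ) : Set ℤ := {i | 0 < i ∧ i ∈ A}

/-- Base values of the members of color `1`. -/
def color1 (A : Set ℤ) : Set ℤ := {i | 0 < i ∧ -i ∈ A}

/-- Base values of all members. -/
def base (A : Set ℤ) : Set ℤ := color0 A ∪ color1 A

/-- Right-to-left minimum letters (colored). -/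
def Rmil (n : ℕ) (π : Equiv.Perm ℤ) : Set ℤ :=
  {x | ∃ i : ℤ, 1 ≤ i ∧ i ≤ n ∧ (∀ j, i < j → j ≤ n → |π i| < |π j|) ∧ x = π i}

/-- Left-to-right minimum letters (colored). -/
def Lmil (n : ℕ) (π : Equiv.Perm ℤ) : Set ℤ :=
  {x | ∃ i : ℤ, 1 ≤ i ∧ i ≤ n ∧ (∀ j, 1 ≤ j → j < i → |π i| < |π j|) ∧ x = π i}

/-- Left-to-right maximum places (colored: the place `i` carries the color of `π i`). -/
def Lmap (n : ℕ) (π : Equiv.Perm ℤ) : Set ℤ :=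
  {x | ∃ i : ℤ, 1 ≤ i ∧ i ≤ n ∧ (∀ j, 1 ≤ j → j < i → |π j| < |π i|) ∧
    x = if π i < 0 then -i else i}

/-- Left-to-right minimum letters (colored) of the word `π(1) π²(1) π³(1) ⋯`. It does not matter
whether the word is stopped when it returns to `1`, as the comparison is strict. -/
def Lmic (π : Equiv.Perm ℤ) : Set ℤ :=
  {x | ∃ k : ℕ, 1 ≤ k ∧ (∀ j : ℕ, 1 ≤ j → j < k → |(π ^ k) 1| < |(π ^ j) 1|) ∧ x = (π ^ k) 1}

/-- The cycle of `a` under the underlying unsigned permutation of the base values. -/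
def cycle (π : Equiv.Perm ℤ) (a : ℤ) : Set ℤ := {i | ∃ k : ℕ, i = |(π ^ k) a|}

/-- The colored cycle set: the minima of the cycles, the color of a cycle being the number of
its barred letters modulo `2`. -/
noncomputable def Cyc (n : ℕ) (π : Equiv.Perm ℤ) : Set ℤ :=
  {x | ∃ a : ℤ, 1 ≤ a ∧ a ≤ n ∧ (∀ i ∈ cycle π a, a ≤ i) ∧
    x = (-1) ^ ({i ∈ cycle π a | π i < 0}).ncard * a}

/-- Twisted positive right-to-left minimum letters. -/
def RmilPlus (n : ℕ) (π : Equiv.Perm ℤ) : Set ℤ := color0 (Rmil n π) ∪ {1}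

/-- Twisted negative right-to-left minimum letters. -/
def RmilMinus (n : ℕ) (π : Equiv.Perm ℤ) : Set ℤ := color1 (Rmil n π) \ {1}

/-- Twisted balanced cycles. -/
noncomputable def CycPlus (n : ℕ) (π : Equiv.Perm ℤ) : Set ℤ := color0 (Cyc n π) ∪ {1}

/-- Twisted unbalanced cycles. -/
noncomputable def CycMinus (n : ℕ) (π : Equiv.Perm ℤ) : Set ℤ := color1 (Cyc n π) \ {1}

/-! ### The two codes and the bijection -/

/-- The set of codes: `c₁ = 1` and `c_i ∈ [-i, i] \ {0}` (`c_i` is the value at index `i - 1`). -/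
def SE (n : ℕ) : Set (Fin n → ℤ) :=
  {c | ∀ i : Fin n, ((i : ℕ) = 0 → c i = 1) ∧ c i ≠ 0 ∧ |c i| ≤ (i : ℕ) + 1}

/-- The window notation `π 1, …, π n`. -/
def window (n : ℕ) (π : Equiv.Perm ℤ) : List ℤ := (List.range n).map (fun k => π ((k : ℤ) + 1))

/-- Change the sign of the first letter of a word. -/
def negHead : List ℤ → List ℤ
  | [] => []
  | a :: w => -a :: w

/-- The algorithm for the C-code, on window notations of length `n`. For `m = n, …, 2`: if `m` is
at position `p`, record `p` and delete `m`; if `-m` is at position `p`, record `-p`, delete `-m`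
and change the sign of the first remaining letter. Finally record the last letter left. -/
def cCodeWord : (n : ℕ) → List ℤ → (Fin n → ℤ)
  | 0, _ => Fin.elim0
  | 1, w => fun _ => w.headI
  | k + 2, w =>
    let m : ℤ := (k : ℤ) + 2
    if m ∈ w then
      Fin.snoc (α := fun _ => ℤ) (cCodeWord (k + 1) (w.erase m)) ((w.idxOf m : ℤ) + 1)
    else
      Fin.snoc (α := fun _ => ℤ) (cCodeWord (k + 1) (negHead (w.erase (-m))))
        (-((w.idxOf (-m) : ℤ) + 1))

/-- The C-code. -/
def cCode (n : ℕ) (π : Equiv.Perm ℤ) : Fin n → ℤ := cCodeWord n (window n π)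

/-- The D-code. For `m = n, …, 2` let `q = π⁻¹ m`; thus `q = p` if the letter `m` is at
position `p`, and `q = -p` if the letter `-m` is at position `p`. Record `q` and replace `π` by
`π * t q m`, which fixes `m`. Finally record `π 1`. -/
def dCode : (n : ℕ) → Equiv.Perm ℤ → (Fin n → ℤ)
  | 0, _ => Fin.elim0
  | 1, π => fun _ => π 1
  | k + 2, π =>
    let m : ℤ := (k : ℤ) + 2
    let q : ℤ := π⁻¹ m
    Fin.snoc (α := fun _ => ℤ) (dCode (k + 1) (π * t q m)) q

/-- The map `ψ = (D-code)⁻¹ ∘ (C-code)` on `D_n`. -/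
noncomputable def psi (n : ℕ) (π : Equiv.Perm ℤ) : Equiv.Perm ℤ :=
  Function.invFunOn (dCode n) (D n : Set (Equiv.Perm ℤ)) (cCode n π)

end EvenSigned

namespace EvenSigned

/-! Both codes strip off the largest letter, and they agree on what they record: if `q` is the
preimage of `n + 1`, then `q` is the last entry of the C-code and of the D-code. The C-code
continues with the word from which `±(n + 1)` is deleted (`IsInsertion`, `cCode_succ`), the D-code
with `π * t q (n + 1)`, which lies in `D n` (`mul_t_mem_D`). Thus it suffices to show that an
insertion with parameter `q` on one side and a multiplication by `t q (n + 1)` on the other change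
the corresponding statistics by the same rule, depending only on `q` and `n`; `statistics_eq` is
then an induction on `n`.

The rules are as follows. Length and sorting index grow by `cost q (n + 1)`. `Rmil` and `Cyc` gain
`q` exactly if `|q| = n + 1`. `Lmil` and `Lmic` gain `n + 1` exactly if `|q| = 1`. `Lmap` keeps its
elements below `|q|` and gains `|q|`. The rule for `Rmil` and `Cyc` is claimed only away from `±1`:
the compensating sign change hits the first letter, which can be a right-to-left minimum only if it
is `±1`, or, for `t (-j) j`, the place `1`, whose cycle has minimum `1`. The twisted statistics
treat `1` uniformly, so this is enough.

For the length, a simple reflection changes the number of inversions, each counted twice, by exactly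
two (`ncard_inversions_mul`). The largest letter travels to the end of the word in `cost q (n + 1)`
simple steps, each removing an inversion (`exists_mul_prod`). This yields reduced words, generation
by `S n`, and the recursion for the length. The D-code is bijective because a step is undone by the
involution `t q (n + 1)`; the C-code is injective, and it is onto by counting. -/

/-! ### Signed permutations and the inclusions `D n ≤ D m` -/

theorem IsSigned.map_zero {n : ℕ} {π : Equiv.Perm ℤ} (hπ : IsSigned n π) : π 0 = 0 := by
  have := hπ.1 0
  simp at this
  omega

theorem IsSigned.mono {n m : ℕ} (h : n ≤ m) {π : Equiv.Perm ℤ} (hπ : IsSigned n π) :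
    IsSigned m π :=
  ⟨hπ.1, fun i hi => hπ.2 i (by omega)⟩

theorem IsSigned.abs_le {n : ℕ} {π : Equiv.Perm ℤ} (hπ : IsSigned n π) {i : ℤ}
    (hi : |i| ≤ n) : |π i| ≤ n := by
  by_contra! h
  have h2 := π.injective (hπ.2 _ h)
  rw [h2] at h
  omega

theorem IsSigned.abs_apply_abs {n : ℕ} {π : Equiv.Perm ℤ} (hπ : IsSigned n π) (i : ℤ) :
    |π (|i|)| = |π i| := by
  rcases abs_choice i with h | h <;> rw [h]
  rw [hπ.1, abs_neg]

theorem negCount_mono {n m : ℕ} (h : n ≤ m) {π : Equiv.Perm ℤ} (hπ : IsSigned n π) :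
    negCount m π = negCount n π := by
  unfold negCount
  congr 1
  ext i
  simp only [Finset.mem_filter, Finset.mem_Icc]
  refine ⟨fun ⟨h1, h2⟩ => ⟨⟨h1.1, ?_⟩, h2⟩, fun ⟨h1, h2⟩ => ⟨⟨h1.1, by omega⟩, h2⟩⟩
  by_contra! h3
  rw [hπ.2 i (by rw [abs_of_pos] <;> omega)] at h2
  omega

theorem D_mono {n m : ℕ} (h : n ≤ m) : D n ≤ D m := fun π hπ =>
  ⟨hπ.1.mono h, by rw [negCount_mono h hπ.1]; exact hπ.2⟩

theorem mem_D_of_fix {n : ℕ} {π : Equiv.Perm ℤ} (hπ : π ∈ D (n + 1))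
    (h : π ((n : ℤ) + 1) = (n : ℤ) + 1) : π ∈ D n := by
  have hs : IsSigned n π := by
    refine ⟨hπ.1.1, fun i hi => ?_⟩
    by_cases h1 : ((n + 1 : ℕ) : ℤ) < |i|
    · exact hπ.1.2 i h1
    · have h2 : |i| = (n : ℤ) + 1 := by push_cast at h1; omega
      rcases abs_choice i with h3 | h3
      · rw [← h3, h2, h]
      · rw [show i = -((n : ℤ) + 1) by omega, hπ.1.1, h]
  exact ⟨hs, by rw [← negCount_mono (Nat.le_succ n) hs]; exact hπ.2⟩

theorem fix_of_mem_D {n : ℕ} {π : Equiv.Perm ℤ} (hπ : π ∈ D n) :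
    π ((n : ℤ) + 1) = (n : ℤ) + 1 :=
  hπ.1.2 _ (by rw [abs_of_pos] <;> omega)

/-- The only other candidate sends `1` to `-1` and has an odd number of negative letters. This is
the base case of every induction below. -/
theorem eq_one_of_mem_D_one {π : Equiv.Perm ℤ} (hπ : π ∈ D 1) : π = 1 := by
  have h1 : π 1 = 1 := by
    have ha := hπ.1.abs_mem (i := 1) (by simp)
    simp only [Finset.mem_Icc, Nat.cast_one] at ha
    rcases abs_choice (π 1) with h | h
    · omega
    · have hneg : negCount 1 π = 1 := by
        unfold negCount
        rw [Finset.card_eq_one]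
        refine ⟨1, ?_⟩
        ext i
        simp only [Finset.mem_filter, Finset.mem_Icc, Finset.mem_singleton, Nat.cast_one]
        constructor
        · omega
        · rintro rfl
          omega
      have := hπ.2
      rw [hneg] at this
      exact absurd this (by decide)
  have h2 := mem_D_of_fix (n := 0) hπ (by simpa using h1)
  ext i
  by_cases hi : i = 0
  · rw [hi, hπ.1.map_zero]; rfl
  · exact h2.1.2 i (by simpa using hi)

/-! ### The elements `t i j` -/

theorem t_self (i : ℤ) : t i i = 1 := by simp [t]

theorem t_apply {i j : ℤ} (h0 : i ≠ 0) (h : |i| < j) (x : ℤ) :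
    t i j x = if x = i then j else if x = j then i else if x = -i then -j
      else if x = -j then -i else x := by
  rw [abs_lt] at h
  rw [t, if_neg (by omega), if_neg (by omega)]
  simp only [Equiv.Perm.mul_apply, Equiv.swap_apply_def]
  split_ifs <;> omega

theorem t_neg_apply {j : ℤ} (h : 1 < j) (x : ℤ) :
    t (-j) j x = if x = 1 ∨ x = -1 ∨ x = j ∨ x = -j then -x else x := by
  rw [t, if_neg (by omega), if_pos rfl]
  simp only [Equiv.Perm.mul_apply, Equiv.swap_apply_def]
  split_ifs <;> omega

theorem t_apply_left {i j : ℤ} (hj : 1 < j) (h0 : i ≠ 0) (h : |i| ≤ j) : t i j i = j := by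
  rcases eq_or_ne i j with rfl | h1
  · simp [t_self]
  rcases eq_or_ne i (-j) with rfl | h2
  · rw [t_neg_apply hj, if_pos (by simp), neg_neg]
  · rw [t_apply h0 (by rw [abs_le] at h; rw [abs_lt]; omega), if_pos rfl]

theorem t_mul_self {i j : ℤ} (hj : 1 < j) (h0 : i ≠ 0) (h : |i| ≤ j) : t i j * t i j = 1 := by
  ext x
  rw [Equiv.Perm.mul_apply, Equiv.Perm.one_apply]
  rcases eq_or_ne i j with rfl | h1
  · simp [t_self]
  rcases eq_or_ne i (-j) with rfl | h2
  · simp only [t_neg_apply hj]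
    split_ifs <;> omega
  · have h3 : |i| < j := by rw [abs_le] at h; rw [abs_lt]; omega
    simp only [t_apply h0 h3]
    rw [abs_lt] at h3
    split_ifs <;> omega

theorem t_mem_D {n : ℕ} (hn : 1 ≤ n) {i : ℤ} (h0 : i ≠ 0) (h : |i| ≤ (n : ℤ) + 1) :
    t i ((n : ℤ) + 1) ∈ D (n + 1) := by
  have hj : 1 < (n : ℤ) + 1 := by omega
  rcases eq_or_ne i ((n : ℤ) + 1) with rfl | h1
  · rw [t_self]; exact one_mem _
  rcases eq_or_ne i (-((n : ℤ) + 1)) with rfl | h2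
  · refine ⟨⟨fun x => ?_, fun x hx => ?_⟩, ?_⟩
    · simp only [t_neg_apply hj]
      split_ifs <;> omega
    · rw [lt_abs] at hx
      push_cast at hx
      rw [t_neg_apply hj, if_neg (by omega)]
    · have : negCount (n + 1) (t (-((n : ℤ) + 1)) ((n : ℤ) + 1)) = 2 := by
        unfold negCount
        rw [Finset.card_eq_two]
        refine ⟨1, (n : ℤ) + 1, by omega, ?_⟩
        ext x
        simp only [Finset.mem_filter, Finset.mem_Icc, Finset.mem_insert, Finset.mem_singleton,
          t_neg_apply hj]
        push_cast
        split_ifs <;> omega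
      rw [this]; decide
  · have h3 : |i| < (n : ℤ) + 1 := by rw [abs_le] at h; rw [abs_lt]; omega
    have h4 := abs_lt.1 h3
    refine ⟨⟨fun x => ?_, fun x hx => ?_⟩, ?_⟩
    · simp only [t_apply h0 h3]
      split_ifs <;> omega
    · rw [lt_abs] at hx
      push_cast at hx
      simp only [t_apply h0 h3]
      split_ifs <;> omega
    · unfold negCount
      rcases lt_or_gt_of_ne h0 with h5 | h5
      · have : negCount (n + 1) (t i ((n : ℤ) + 1)) = 2 := by
          unfold negCount
          rw [Finset.card_eq_two]
          refine ⟨-i, (n : ℤ) + 1, by omega, ?_⟩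
          ext x
          simp only [Finset.mem_filter, Finset.mem_Icc, Finset.mem_insert,
            Finset.mem_singleton, t_apply h0 h3]
          push_cast
          split_ifs <;> omega
        unfold negCount at this
        rw [this]; decide
      · rw [Finset.card_eq_zero.2]
        · decide
        · rw [Finset.filter_eq_empty_iff]
          intro x hx
          rw [Finset.mem_Icc] at hx
          rw [t_apply h0 h3]
          split_ifs <;> omega

theorem S_subset_D (n : ℕ) : S n ⊆ D n := by
  rintro g (⟨h, rfl⟩ | ⟨i, h1, h2, rfl⟩)
  · exact D_mono h (t_mem_D (n := 1) le_rfl (by norm_num) (by norm_num))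
  · lift i to ℕ using by omega
    exact D_mono (n := i + 1) (by omega) (t_mem_D (by omega) (by omega) (by
      rw [Nat.abs_cast]; omega))

theorem S_mono {n m : ℕ} (h : n ≤ m) : S n ⊆ S m := by
  rintro g (⟨h, rfl⟩ | ⟨i, h1, h2, rfl⟩)
  · exact Or.inl ⟨by omega, rfl⟩
  · exact Or.inr ⟨i, h1, by omega, rfl⟩

/-! ### Removing the largest letter by a reflection -/

theorem inv_apply_ne_zero {n : ℕ} {π : Equiv.Perm ℤ} (hπ : π ∈ D (n + 1)) :
    π⁻¹ ((n : ℤ) + 1) ≠ 0 :=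
  hπ.1.inv.ne_zero (by omega)

theorem abs_inv_apply_le {n : ℕ} {π : Equiv.Perm ℤ} (hπ : π ∈ D (n + 1)) :
    |π⁻¹ ((n : ℤ) + 1)| ≤ (n : ℤ) + 1 := by
  have := hπ.1.inv.abs_le (i := (n : ℤ) + 1) (by rw [abs_of_pos] <;> push_cast <;> omega)
  push_cast at this
  exact this

/-- The reflection carries `n + 1` to its preimage `q`, so the product fixes `n + 1`. This is one
step of the D-code and splits off one factor of the factorization. -/
theorem mul_t_mem_D {n : ℕ} (hn : 1 ≤ n) {π : Equiv.Perm ℤ} (hπ : π ∈ D (n + 1)) :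
    π * t (π⁻¹ ((n : ℤ) + 1)) ((n : ℤ) + 1) ∈ D n := by
  have h1 := inv_apply_ne_zero hπ
  have h2 := abs_inv_apply_le hπ
  refine mem_D_of_fix (mul_mem hπ (t_mem_D hn h1 h2)) ?_
  set q := π⁻¹ ((n : ℤ) + 1) with hq
  have h3 : t q ((n : ℤ) + 1) ((n : ℤ) + 1) = q := by
    have h4 := t_apply_left (by omega) h1 h2
    have h5 := congrArg (fun σ : Equiv.Perm ℤ => σ q) (t_mul_self (by omega) h1 h2)
    simpa [h4] using h5
  rw [Equiv.Perm.mul_apply, h3, hq]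
  simp

/-- Since `σ` fixes `n + 1`, the parameter `q` can be read off from the product; this is what makes
codes and factorizations unique. -/
theorem mul_t_inv_apply {n : ℕ} (hn : 1 ≤ n) {σ : Equiv.Perm ℤ} (hσ : σ ∈ D n) {q : ℤ}
    (h0 : q ≠ 0) (h : |q| ≤ (n : ℤ) + 1) :
    (σ * t q ((n : ℤ) + 1))⁻¹ ((n : ℤ) + 1) = q := by
  rw [Equiv.Perm.inv_eq_iff_eq, Equiv.Perm.mul_apply, t_apply_left (by omega) h0 h,
    fix_of_mem_D hσ]

/-! ### The D-code -/

theorem dCode_succ {n : ℕ} (hn : 1 ≤ n) (π : Equiv.Perm ℤ) :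
    dCode (n + 1) π = Fin.snoc (α := fun _ => ℤ)
      (dCode n (π * t (π⁻¹ ((n : ℤ) + 1)) ((n : ℤ) + 1))) (π⁻¹ ((n : ℤ) + 1)) := by
  obtain ⟨k, rfl⟩ : ∃ k, n = k + 1 := ⟨n - 1, by omega⟩
  have : ((k + 1 : ℕ) : ℤ) + 1 = (k : ℤ) + 2 := by push_cast; ring
  rw [this]
  rfl

theorem snoc_mem_SE {n : ℕ} (hn : 1 ≤ n) {c : Fin n → ℤ} {q : ℤ} :
    Fin.snoc (α := fun _ => ℤ) c q ∈ SE (n + 1) ↔ c ∈ SE n ∧ q ≠ 0 ∧ |q| ≤ (n : ℤ) + 1 := by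
  constructor
  · intro h
    refine ⟨fun i => ?_, ?_⟩
    · simpa using h i.castSucc
    · have := (h (Fin.last n)).2
      simpa using this
  · rintro ⟨h1, h2⟩ i
    refine Fin.lastCases ?_ (fun i => ?_) i
    · simp only [Fin.snoc_last, Fin.val_last]
      exact ⟨fun h => by omega, h2⟩
    · simpa using h1 i

theorem snoc_eq_snoc {n : ℕ} {c d : Fin n → ℤ} {p q : ℤ} :
    Fin.snoc (α := fun _ => ℤ) c p = Fin.snoc (α := fun _ => ℤ) d q ↔ c = d ∧ p = q := by
  constructor
  · intro h
    refine ⟨?_, ?_⟩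
    · have := congrArg (Fin.init (α := fun _ => ℤ)) h
      simpa using this
    · have := congrFun h (Fin.last n)
      simpa using this
  · rintro ⟨rfl, rfl⟩; rfl

theorem exists_snoc {n : ℕ} (c : Fin (n + 1) → ℤ) :
    ∃ (d : Fin n → ℤ) (q : ℤ), c = Fin.snoc (α := fun _ => ℤ) d q :=
  ⟨Fin.init (α := fun _ => ℤ) c, c (Fin.last n), (Fin.snoc_init_self c).symm⟩

theorem dCode_bijOn {n : ℕ} (hn : 1 ≤ n) : Set.BijOn (dCode n) (D n) (SE n) := by
  induction n, hn using Nat.le_induction with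
  | base =>
    refine ⟨fun π hπ => ?_, fun π hπ τ hτ _ => ?_, fun c hc => ?_⟩
    · rw [eq_one_of_mem_D_one hπ]
      intro i
      simp [dCode]
    · rw [eq_one_of_mem_D_one hπ, eq_one_of_mem_D_one hτ]
    · refine ⟨1, one_mem _, ?_⟩
      ext i
      rw [(hc i).1 (by omega)]
      simp [dCode]
  | succ n hn ih =>
    refine ⟨fun π hπ => ?_, fun π hπ τ hτ h => ?_, fun c hc => ?_⟩
    · rw [dCode_succ hn, snoc_mem_SE hn]
      exact ⟨ih.mapsTo (mul_t_mem_D hn hπ), inv_apply_ne_zero hπ, abs_inv_apply_le hπ⟩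
    · rw [dCode_succ hn, dCode_succ hn, snoc_eq_snoc] at h
      have h1 := ih.injOn (mul_t_mem_D hn hπ) (mul_t_mem_D hn hτ) h.1
      rw [h.2] at h1
      exact mul_right_cancel h1
    · obtain ⟨d, q, rfl⟩ := exists_snoc c
      rw [snoc_mem_SE hn] at hc
      obtain ⟨σ, hσ, rfl⟩ := ih.surjOn hc.1
      have hj : 1 < (n : ℤ) + 1 := by omega
      refine ⟨σ * t q ((n : ℤ) + 1),
        mul_mem (D_mono (Nat.le_succ n) hσ) (t_mem_D hn hc.2.1 hc.2.2), ?_⟩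
      rw [dCode_succ hn, mul_t_inv_apply hn hσ hc.2.1 hc.2.2, mul_assoc,
        t_mul_self hj hc.2.1 hc.2.2, mul_one]

theorem SE_finite (n : ℕ) : (SE n).Finite := by
  refine (Set.Finite.pi' (fun i : Fin n => Set.finite_Icc (-((n : ℤ))) n)).subset ?_
  intro c hc i
  have h1 := abs_le.1 (hc i).2.2
  have h2 := i.2
  rw [Set.mem_Icc]
  omega

/-! ### Factorizations and the sorting index -/

/-- The contribution of the reflection `t q j` to the sorting index. -/
def cost (q j : ℤ) : ℤ := j - q - 2 * (if q < 0 then 1 else 0)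

theorem IsFactorization.mem_D {n : ℕ} {π : Equiv.Perm ℤ} {L : List (ℤ × ℤ)}
    (h : IsFactorization n π L) : π ∈ D n := by
  obtain ⟨h1, -, rfl⟩ := h
  refine list_prod_mem fun g hg => ?_
  obtain ⟨p, hp, rfl⟩ := List.mem_map.1 hg
  obtain ⟨h2, h3, h4, h5⟩ := h1 p hp
  obtain ⟨k, hk⟩ : ∃ k : ℕ, p.2 = (k : ℤ) + 1 := ⟨(p.2 - 1).toNat, by omega⟩
  refine D_mono (n := k + 1) (by omega) ?_
  rw [hk]
  refine t_mem_D (by omega) h4 ?_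
  rw [← hk]
  rcases h5 with h5 | h5
  · exact h5.le
  · rw [h5, abs_neg, abs_of_pos (by omega)]

/-- Factors with second index at most `n` fix `n + 1`, so the factor with index `n + 1` is forced:
its first index is the preimage of `n + 1`, and it is absent if that preimage is `n + 1` itself. -/
theorem isFactorization_succ {n : ℕ} (hn : 1 ≤ n) {π : Equiv.Perm ℤ} (hπ : π ∈ D (n + 1))
    {q : ℤ} (hq : q = π⁻¹ ((n : ℤ) + 1)) {L : List (ℤ × ℤ)} :
    IsFactorization (n + 1) π L ↔ ∃ L', IsFactorization n (π * t q ((n : ℤ) + 1)) L' ∧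
      L = L' ++ if q = (n : ℤ) + 1 then [] else [(q, (n : ℤ) + 1)] := by
  have hj : 1 < (n : ℤ) + 1 := by omega
  have q0 : q ≠ 0 := hq ▸ inv_apply_ne_zero hπ
  have q1 : |q| ≤ (n : ℤ) + 1 := hq ▸ abs_inv_apply_le hπ
  constructor
  · intro h
    have key : ∀ L', IsFactorization (n + 1) π L' → (∀ p ∈ L', p.2 ≤ n) →
        IsFactorization n π L' := fun L' h h' =>
      ⟨fun p hp => ⟨(h.1 p hp).1, h' p hp, (h.1 p hp).2.2⟩, h.2⟩
    -- Either no factor has index `n + 1`, and then `π` fixes `n + 1`, or the strictly increasing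
    -- second indices force that factor to be the last one.
    by_cases hL : ∀ p ∈ L, p.2 ≤ n
    · have h1 := key L h hL
      have h2 : q = (n : ℤ) + 1 := by
        rw [hq, Equiv.Perm.inv_eq_iff_eq, fix_of_mem_D h1.mem_D]
      exact ⟨L, by rw [h2, t_self, mul_one]; exact h1, by simp [h2]⟩
    · push Not at hL
      obtain ⟨p, hp, hp'⟩ := hL
      rcases L.eq_nil_or_concat with rfl | ⟨L', r, rfl⟩
      · simp at hp
      obtain ⟨h1, h2, h3⟩ := h
      rw [List.concat_eq_append] at *
      simp only [List.map_append, List.map_cons, List.map_nil, List.pairwise_append,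
        List.mem_singleton, List.mem_map, forall_eq] at h2
      have hr := h1 r (by simp)
      push_cast at hr
      have hr2 : r.2 = (n : ℤ) + 1 := by
        rcases List.mem_append.1 hp with h4 | h4
        · have := h2.2.2 _ ⟨p, h4, rfl⟩
          omega
        · simp only [List.mem_singleton] at h4
          subst h4
          omega
      rw [List.map_append, List.prod_append] at h3
      simp only [List.map_cons, List.map_nil, List.prod_cons, List.prod_nil, mul_one] at h3
      have hr1 : |r.1| ≤ (n : ℤ) + 1 := by
        rcases hr.2.2.2 with h5 | h5
        · rw [hr2] at h5; exact h5.le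
        · rw [h5, hr2, abs_neg, abs_of_pos]; omega
      have hL' : IsFactorization n (L'.map (fun p => t p.1 p.2)).prod L' := by
        refine ⟨fun p hp => ?_, h2.1, rfl⟩
        have h5 := h1 p (by simp [hp])
        have h6 := h2.2.2 _ ⟨p, hp, rfl⟩
        exact ⟨h5.1, by omega, h5.2.2⟩
      have hqr : q = r.1 := by
        rw [hq, ← h3, hr2]
        exact mul_t_inv_apply hn hL'.mem_D hr.2.2.1 hr1
      refine ⟨L', ?_, ?_⟩
      · rw [← h3, hr2, hqr, mul_assoc, t_mul_self hj hr.2.2.1 hr1, mul_one]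
        exact hL'
      · have : q ≠ (n : ℤ) + 1 := by
          rw [hqr]
          rcases hr.2.2.2 with h5 | h5
          · rw [abs_lt] at h5; omega
          · omega
        rw [if_neg this, hqr, ← hr2]
  · rintro ⟨L', h, rfl⟩
    split_ifs with h1
    · rw [h1, t_self, mul_one] at h
      rw [List.append_nil]
      exact ⟨fun p hp => ⟨(h.1 p hp).1, by have := (h.1 p hp).2.1; push_cast; omega,
        (h.1 p hp).2.2⟩, h.2⟩
    · refine ⟨fun p hp => ?_, ?_, ?_⟩
      · rcases List.mem_append.1 hp with h4 | h4
        · exact ⟨(h.1 p h4).1, by have := (h.1 p h4).2.1; push_cast; omega, (h.1 p h4).2.2⟩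
        · rw [List.mem_singleton] at h4
          subst h4
          refine ⟨hj, by push_cast; exact le_rfl, q0, ?_⟩
          rw [abs_le] at q1
          rw [abs_lt]
          simp only
          omega
      · simp only [List.map_append, List.map_cons, List.map_nil, List.pairwise_append,
          List.mem_singleton, List.mem_map, forall_eq]
        refine ⟨h.2.1, by simp, ?_⟩
        rintro a ⟨p, hp, rfl⟩
        have := (h.1 p hp).2.1
        omega
      · rw [List.map_append, List.prod_append, h.2.2]
        simp only [List.map_cons, List.map_nil, List.prod_cons, List.prod_nil, mul_one]
        rw [mul_assoc, t_mul_self hj q0 q1, mul_one]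

theorem existsUnique_isFactorization {n : ℕ} (hn : 1 ≤ n) {π : Equiv.Perm ℤ} (hπ : π ∈ D n) :
    ∃! L, IsFactorization n π L := by
  induction n, hn using Nat.le_induction generalizing π with
  | base =>
    rw [eq_one_of_mem_D_one hπ]
    refine ⟨[], ⟨by simp, by simp, by simp⟩, fun L hL => ?_⟩
    rw [List.eq_nil_iff_forall_not_mem]
    intro p hp
    have := hL.1 p hp
    push_cast at this
    omega
  | succ n hn ih =>
    obtain ⟨L, h1, h2⟩ := ih (mul_t_mem_D hn hπ)
    refine ⟨_, (isFactorization_succ hn hπ rfl).2 ⟨L, h1, rfl⟩, fun L' hL' => ?_⟩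
    obtain ⟨L'', h3, h4⟩ := (isFactorization_succ hn hπ rfl).1 hL'
    rw [h4, h2 _ h3]

theorem sor_eq {n : ℕ} (hn : 1 ≤ n) {π : Equiv.Perm ℤ} {L : List (ℤ × ℤ)}
    (h : IsFactorization n π L) : sor n π = (L.map (fun p => cost p.1 p.2)).sum := by
  have h1 : ∃ L, IsFactorization n π L := ⟨L, h⟩
  rw [sor, dif_pos h1, (existsUnique_isFactorization hn h.mem_D).unique h1.choose_spec h]
  rfl

theorem sor_one : sor 1 1 = 0 := by
  rw [sor_eq le_rfl (L := []) ⟨by simp, by simp, by simp⟩]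
  simp

theorem sor_mul_t {n : ℕ} (hn : 1 ≤ n) {σ : Equiv.Perm ℤ} (hσ : σ ∈ D n) {q : ℤ} (h0 : q ≠ 0)
    (hq : |q| ≤ (n : ℤ) + 1) :
    sor (n + 1) (σ * t q ((n : ℤ) + 1)) = sor n σ + cost q ((n : ℤ) + 1) := by
  obtain ⟨L, hL, -⟩ := existsUnique_isFactorization hn hσ
  have hj : 1 < (n : ℤ) + 1 := by omega
  have h1 := (isFactorization_succ hn (mul_mem (D_mono (Nat.le_succ n) hσ) (t_mem_D hn h0 hq))
    (mul_t_inv_apply hn hσ h0 hq).symm).2 ⟨L, by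
      rw [mul_assoc, t_mul_self hj h0 hq, mul_one]; exact hL, rfl⟩
  rw [sor_eq (by omega) h1, sor_eq hn hL]
  split_ifs with h
  · rw [List.append_nil, h, cost, if_neg (by omega)]
    simp
  · simp

/-! ### Inversions and length -/

/-- The inversions of `π`, as pairs of places in `ℤ`; every inversion in the sense of the root
system of type `D` gives two such pairs. -/
def inversions (π : Equiv.Perm ℤ) : Set (ℤ × ℤ) :=
  {p | p.1 ≠ 0 ∧ p.2 ≠ 0 ∧ p.1 < p.2 ∧ p.1 + p.2 ≠ 0 ∧ π p.2 < π p.1}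

theorem inversions_finite {n : ℕ} {π : Equiv.Perm ℤ} (hπ : IsSigned n π) :
    (inversions π).Finite := by
  refine ((Set.finite_Icc (-(n : ℤ)) n).prod (Set.finite_Icc (-(n : ℤ)) n)).subset ?_
  rintro ⟨a, b⟩ ⟨h1, h2, h3, h4, h5⟩
  simp only [Set.mem_prod, Set.mem_Icc, ← abs_le] at *
  -- Since `π` preserves the box `|x| ≤ n` and is the identity outside, no pair with a place outside
  -- the box is inverted.
  have key : ∀ x : ℤ, |x| ≤ n ∧ |π x| ≤ n ∨ (n : ℤ) < |x| ∧ π x = x := fun x => by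
    rcases le_or_gt |x| n with h | h
    · exact Or.inl ⟨h, hπ.abs_le h⟩
    · exact Or.inr ⟨h, hπ.2 x h⟩
  rcases key a with ⟨ha, ha'⟩ | ⟨ha, ha'⟩ <;> rcases key b with ⟨hb, hb'⟩ | ⟨hb, hb'⟩ <;>
    (simp only [abs_le, lt_abs] at *; omega)

theorem inversions_one : inversions 1 = ∅ := by
  rw [Set.eq_empty_iff_forall_notMem]
  rintro ⟨a, b⟩ ⟨-, -, h1, -, h2⟩
  exact absurd h1 (not_lt.2 h2.le)

/-- The reflection `s` is simple, and `(a, b)` is the pair of places that it exchanges. -/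
structure IsSimple (s : Equiv.Perm ℤ) (a b : ℤ) : Prop where
  neg : ∀ x, s (-x) = -s x
  invol : ∀ x, s (s x) = x
  left : s a = b
  ne : a ≠ 0 ∧ b ≠ 0
  lt : a < b
  add_ne : a + b ≠ 0
  mono : ∀ x y, x ≠ 0 → y ≠ 0 → x < y → x + y ≠ 0 → (x, y) ≠ (a, b) → (x, y) ≠ (-b, -a) →
    s x < s y

theorem isSimple_t {i : ℤ} (hi : 1 ≤ i) : IsSimple (t i (i + 1)) i (i + 1) := by
  have h := t_apply (i := i) (j := i + 1) (by omega) (by rw [abs_lt]; omega)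
  constructor
  · intro x; simp only [h]; split_ifs <;> omega
  · intro x; simp only [h]; split_ifs <;> omega
  · simp [h]
  · omega
  · omega
  · omega
  · intro x y h1 h2 h3 h4 h5 h6
    simp only [Ne, Prod.mk.injEq] at h5 h6
    simp only [h]
    split_ifs <;> omega

theorem isSimple_t_neg : IsSimple (t (-1) 2) (-1) 2 := by
  have h := t_apply (i := -1) (j := 2) (by omega) (by norm_num)
  constructor
  · intro x; simp only [h]; split_ifs <;> omega
  · intro x; simp only [h]; split_ifs <;> first | omega | contradiction
  · simp [h]
  · omega
  · omega
  · omega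
  · intro x y h1 h2 h3 h4 h5 h6
    simp only [Ne, Prod.mk.injEq] at h5 h6
    simp only [h]
    split_ifs <;> omega

theorem exists_isSimple {n : ℕ} {g : Equiv.Perm ℤ} (hg : g ∈ S n) : ∃ a b, IsSimple g a b := by
  rcases hg with ⟨-, rfl⟩ | ⟨i, h1, -, rfl⟩
  exacts [⟨_, _, isSimple_t_neg⟩, ⟨_, _, isSimple_t h1⟩]

/-- A simple reflection preserves the order of all admissible pairs of places except `(a, b)` and
its mirror image `(-b, -a)`. Hence it transports the inversions of `π` to inversions of `π * s`, and
only these two pairs are new. -/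
theorem ncard_inversions_mul {n : ℕ} {π s : Equiv.Perm ℤ} {a b : ℤ} (hπ : IsSigned n π)
    (hs : IsSimple s a b) (h : π a < π b) :
    (inversions (π * s)).ncard = (inversions π).ncard + 2 := by
  obtain ⟨neg, invol, left, ⟨ha, hb⟩, lt, add_ne, mono⟩ := hs
  have right : s b = a := by rw [← left, invol]
  have s0 : s 0 = 0 := by have := neg 0; simp at this; omega
  have sne : ∀ x, x ≠ 0 → s x ≠ 0 := fun x hx h0 => hx (by rw [← invol x, h0, s0])
  have sadd : ∀ x y, x + y ≠ 0 → s x + s y ≠ 0 := fun x y hxy h0 => by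
    have h1 : s x = s (-y) := by rw [neg]; omega
    have := s.injective h1
    omega
  have hE : inversions (π * s) =
      (fun p : ℤ × ℤ => (s p.1, s p.2)) '' inversions π ∪ {(a, b), (-b, -a)} := by
    ext ⟨x, y⟩
    simp only [Set.mem_union, Set.mem_image, Prod.mk.injEq, Set.mem_insert_iff,
      Set.mem_singleton_iff, inversions, Set.mem_ofPred_eq, Equiv.Perm.mul_apply, Prod.exists]
    constructor
    · rintro ⟨h1, h2, h3, h4, h5⟩
      by_cases h6 : (x, y) = (a, b) ∨ (x, y) = (-b, -a)
      · exact Or.inr (by simpa using h6)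
      · push Not at h6
        exact Or.inl ⟨s x, s y, ⟨sne _ h1, sne _ h2, mono x y h1 h2 h3 h4 h6.1 h6.2,
          sadd _ _ h4, h5⟩, invol x, invol y⟩
    · rintro (⟨x, y, ⟨h1, h2, h3, h4, h5⟩, rfl, rfl⟩ | ⟨rfl, rfl⟩ | ⟨rfl, rfl⟩)
      · refine ⟨sne _ h1, sne _ h2, mono x y h1 h2 h3 h4 ?_ ?_, sadd _ _ h4, ?_⟩
        · simp only [Ne, Prod.mk.injEq]
          rintro ⟨rfl, rfl⟩
          omega
        · simp only [Ne, Prod.mk.injEq]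
          rintro ⟨rfl, rfl⟩
          rw [hπ.1, hπ.1] at h5
          omega
        · rwa [invol, invol]
      · exact ⟨ha, hb, lt, add_ne, by rwa [left, right]⟩
      · refine ⟨by omega, by omega, by omega, by omega, ?_⟩
        rw [neg, neg, left, right, hπ.1, hπ.1]
        omega
  have hfin := inversions_finite hπ
  rw [hE, Set.ncard_union_eq _ (hfin.image _) (by simp), Set.ncard_image_of_injective,
    Set.ncard_pair]
  · simp only [Ne, Prod.mk.injEq]; omega
  · rintro ⟨x, y⟩ ⟨z, w⟩ h
    simpa using h
  · rw [Set.disjoint_left]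
    rintro _ ⟨⟨x, y⟩, ⟨-, -, h3, -, -⟩, rfl⟩ h7
    simp only [Set.mem_insert_iff, Set.mem_singleton_iff, Prod.mk.injEq] at h7
    simp only at h3
    rcases h7 with ⟨h7, h8⟩ | ⟨h7, h8⟩
    · rw [← invol x, ← invol y, h7, h8, left, right] at h3
      omega
    · rw [← invol x, ← invol y, h7, h8, neg, neg, left, right] at h3
      omega

theorem ncard_inversions_mul_le {n : ℕ} {π g : Equiv.Perm ℤ} (hπ : IsSigned n π)
    (hg : g ∈ S n) : (inversions (π * g)).ncard ≤ (inversions π).ncard + 2 := by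
  obtain ⟨a, b, hs⟩ := exists_isSimple hg
  rcases lt_or_gt_of_ne (π.injective.ne hs.lt.ne) with h | h
  · exact (ncard_inversions_mul hπ hs h).le
  · have h1 := ncard_inversions_mul (hπ.mul (S_subset_D n hg).1) hs (by
      rw [Equiv.Perm.mul_apply, Equiv.Perm.mul_apply, ← hs.left, hs.invol]
      rwa [hs.left])
    have h2 : π * g * g = π := by
      ext x
      simp [hs.invol]
    rw [h2] at h1
    omega

theorem ncard_inversions_prod_le {n : ℕ} (L : List (Equiv.Perm ℤ)) (hL : ∀ g ∈ L, g ∈ S n) :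
    (inversions L.prod).ncard ≤ 2 * L.length := by
  induction L using List.reverseRecOn with
  | nil => simp [inversions_one]
  | append_singleton L g ih =>
    have h1 := ih fun g hg => hL g (by simp [hg])
    have h2 : L.prod ∈ D n := list_prod_mem fun g hg => S_subset_D n (hL g (by simp [hg]))
    have h3 := ncard_inversions_mul_le h2.1 (hL g (by simp))
    simp only [List.prod_append, List.prod_cons, List.prod_nil, mul_one, List.length_append,
      List.length_cons, List.length_nil]
    omega

/-- A word is reduced if it attains the bound that each generator creates at most two of the counted
pairs. -/
theorem len_eq {n : ℕ} {L : List (Equiv.Perm ℤ)} (hL : ∀ g ∈ L, g ∈ S n)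
    (h : (inversions L.prod).ncard = 2 * L.length) : len n L.prod = L.length := by
  refine le_antisymm (Nat.sInf_le ⟨L, hL, rfl, rfl⟩) ?_
  refine le_csInf ⟨_, L, hL, rfl, rfl⟩ ?_
  rintro k ⟨L', h1, rfl, h2⟩
  have := ncard_inversions_prod_le L' h1
  rw [h2] at this
  omega

/-! ### Removing the largest letter from a word -/

/-- The word of `π` arises from the word of `π'` by the insertion of the letter `n + 1` at place
`q`, or by a change of the sign of the first letter and the insertion of `-(n + 1)` at place `-q`. -/
structure IsInsertion (n : ℕ) (π π' : Equiv.Perm ℤ) (q : ℤ) : Prop where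
  at_place : π q = (n : ℤ) + 1
  before : ∀ i, 1 ≤ i → i < |q| → π i = if q < 0 ∧ i = 1 then -π' i else π' i
  after : ∀ i, |q| ≤ i → i ≤ n → π (i + 1) = if q < 0 ∧ i = 1 then -π' i else π' i

/-- The letter `n + 1` moves from place `q` along `-p, …, -1, 2, 3, …, n + 1`, or along the final
part of this path, by simple reflections. The generator `t (-1) 2` jumps from `-1` to `2`, so the
places `0` and `1` are skipped; this is the correction `-2` in `cost` for negative `q`. -/
theorem exists_mul_prod_aux {n : ℕ} (hn : 1 ≤ n) (k : ℕ) {π : Equiv.Perm ℤ} (hπ : π ∈ D (n + 1))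
    {q : ℤ} (hq : π q = (n : ℤ) + 1) (hk : cost q ((n : ℤ) + 1) = k) :
    ∃ π' ∈ D n, IsInsertion n π π' q ∧ ∃ L : List (Equiv.Perm ℤ), (∀ g ∈ L, g ∈ S (n + 1)) ∧
      π = π' * L.prod ∧ L.length = k ∧
      (inversions π).ncard = (inversions π').ncard + 2 * k := by
  have hq' : q = π⁻¹ ((n : ℤ) + 1) := by rw [Equiv.Perm.eq_inv_iff_eq, hq]
  have q0 : q ≠ 0 := hq' ▸ inv_apply_ne_zero hπ
  have q1 := abs_le.1 (hq' ▸ abs_inv_apply_le hπ : |q| ≤ (n : ℤ) + 1)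
  have hneg : π (-q) = -((n : ℤ) + 1) := by rw [hπ.1.1, hq]
  have hlt : ∀ x, |x| ≤ (n : ℤ) + 1 → x ≠ q → π x < (n : ℤ) + 1 := fun x hx hxq => by
    have h1 := abs_le.1 (hπ.1.abs_le (i := x) (by push_cast; exact hx))
    have h2 : π x ≠ (n : ℤ) + 1 := fun h => hxq (π.injective (h.trans hq.symm))
    push_cast at h1
    omega
  have hgt : ∀ x, |x| ≤ (n : ℤ) + 1 → x ≠ -q → -((n : ℤ) + 1) < π x := fun x hx hxq => by
    have h1 := hlt (-x) (by rwa [abs_neg]) (by omega)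
    rw [hπ.1.1] at h1
    omega
  induction k generalizing π q with
  | zero =>
    -- For negative `q` the cost is at least `n`, hence positive, so cost zero means that the letter
    -- has arrived.
    have : q = (n : ℤ) + 1 := by
      unfold cost at hk
      split_ifs at hk <;> push_cast at hk <;> omega
    subst this
    refine ⟨π, mem_D_of_fix hπ hq, ⟨hq, fun i _ _ => ?_, fun i h1 h2 => ?_⟩, [], by simp,
      by simp, by simp, by simp⟩
    · rw [if_neg (by omega)]
    · rw [abs_of_pos (by omega)] at h1
      omega
  | succ k ih =>
    -- a generator that moves the largest letter one place closer to the end of the word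
    have main : ∀ (g : Equiv.Perm ℤ) (a b r : ℤ), g ∈ S (n + 1) → IsSimple g a b →
        π b < π a → g r = q → cost r ((n : ℤ) + 1) = k →
        (∀ π', IsInsertion n (π * g) π' r → IsInsertion n π π' q) →
        ∃ π' ∈ D n, IsInsertion n π π' q ∧ ∃ L : List (Equiv.Perm ℤ),
          (∀ g ∈ L, g ∈ S (n + 1)) ∧ π = π' * L.prod ∧ L.length = k + 1 ∧
          (inversions π).ncard = (inversions π').ncard + 2 * (k + 1) := by
      intro g a b r hg hs hab hr hc hins
      have hD := mul_mem hπ (S_subset_D _ hg)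
      have hr' : (π * g) r = (n : ℤ) + 1 := by rw [Equiv.Perm.mul_apply, hr, hq]
      have e1 : r = (π * g)⁻¹ ((n : ℤ) + 1) := by rw [Equiv.Perm.eq_inv_iff_eq, hr']
      have hl : ∀ x, |x| ≤ (n : ℤ) + 1 → x ≠ r → (π * g) x < (n : ℤ) + 1 := fun x hx hxq => by
        have h1 := abs_le.1 (hD.1.abs_le (i := x) (by push_cast; exact hx))
        have h2 : (π * g) x ≠ (n : ℤ) + 1 := fun h =>
          hxq ((π * g).injective (h.trans hr'.symm))
        simp only [Nat.cast_add, Nat.cast_one] at h1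
        omega
      obtain ⟨π', h1, h2, L, h3, h4, h5, h6⟩ := ih hD hr' hc e1 (e1 ▸ inv_apply_ne_zero hD)
        (abs_le.1 (e1 ▸ abs_inv_apply_le hD)) (by rw [hD.1.1, hr']) hl
        (fun x hx hxq => by
          have h1 := hl (-x) (by rwa [abs_neg]) (by omega)
          rw [hD.1.1] at h1
          exact neg_lt.1 h1)
      have hgg : g * g = 1 := by ext x; simp [hs.invol]
      refine ⟨π', h1, hins π' h2, L ++ [g], ?_, ?_, by simp [h5], ?_⟩
      · intro x hx
        rcases List.mem_append.1 hx with hx | hx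
        · exact h3 x hx
        · rw [List.mem_singleton] at hx
          rwa [hx]
      · rw [List.prod_append, List.prod_singleton, ← mul_assoc, ← h4, mul_assoc, hgg, mul_one]
      · have h7 := ncard_inversions_mul hD.1 hs (by
          rw [Equiv.Perm.mul_apply, Equiv.Perm.mul_apply, ← hs.left, hs.invol]
          rwa [hs.left])
        rw [mul_assoc, hgg, mul_one] at h7
        omega
    unfold cost at hk main
    rcases lt_or_gt_of_ne q0 with h | h
    · rw [if_pos h] at hk
      rcases eq_or_ne q (-1) with rfl | h'
      · have ht := t_apply (i := -1) (j := 2) (by omega) (by norm_num)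
        refine main _ _ _ 2 (Or.inl ⟨by omega, rfl⟩) isSimple_t_neg ?_ (by simp [ht])
          (by rw [if_neg (by omega)]; push_cast at hk; omega) ?_
        · rw [hq]
          exact hlt _ (by rw [abs_of_pos] <;> omega) (by omega)
        · rintro π' ⟨h1, h2, h3⟩
          simp only [Equiv.Perm.mul_apply, ht, abs_two] at h1 h2 h3
          refine ⟨hq, fun i h4 h5 => ?_, fun i h4 h5 => ?_⟩
          · simp only [abs_neg, abs_one] at h5
            omega
          · simp only [abs_neg, abs_one] at h4
            by_cases h6 : i = 1
            · subst h6
              have h7 := h2 1 le_rfl (by omega)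
              simp at h7
              simp only [neg_lt_zero, zero_lt_one, and_self, if_true]
              rw [← h7, hπ.1.1]
              norm_num
            · have h7 := h3 i (by omega) h5
              rw [if_neg (by omega), if_neg (by omega), if_neg (by omega), if_neg (by omega),
                if_neg (by omega)] at h7
              rw [h7, if_neg (by omega)]
      · obtain ⟨p, rfl⟩ : ∃ p, q = -(p + 1) := ⟨-q - 1, by omega⟩
        -- The letter `-(n + 1)` moves one place to the left, from `p + 1` to `p`; being the least
        -- letter, it forms an inversion with its left neighbor.
        have hp : 1 ≤ p := by omega
        have ht := t_apply (i := p) (j := p + 1) (by omega) (by rw [abs_lt]; omega)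
        refine main _ _ _ (-p) (Or.inr ⟨p, hp, by push_cast; omega, rfl⟩) (isSimple_t hp) ?_
          (by rw [ht, if_neg (by omega), if_neg (by omega), if_pos rfl])
          (by rw [if_pos (by omega)]; push_cast at hk; omega) ?_
        · rw [neg_neg] at hneg
          rw [hneg]
          exact hgt _ (by rw [abs_of_pos] <;> omega) (by omega)
        · rintro π' ⟨h1, h2, h3⟩
          simp only [Equiv.Perm.mul_apply, ht, abs_neg, abs_of_pos (show 0 < p by omega)]
            at h1 h2 h3
          refine ⟨hq, fun i h4 h5 => ?_, fun i h4 h5 => ?_⟩ <;>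
            rw [abs_neg, abs_of_pos (by omega)] at *
          · by_cases h6 : i = p
            · have h7 := h3 i (by omega) (by omega)
              rw [if_neg (by omega), if_pos (by omega)] at h7
              rw [h6] at h7 ⊢
              rw [h7]
              congr 1
              simp only [eq_iff_iff]
              omega
            · have h7 := h2 i h4 (by omega)
              rw [if_neg (by omega), if_neg (by omega), if_neg (by omega),
                if_neg (by omega)] at h7
              rw [h7]
              congr 1
              simp only [eq_iff_iff]
              omega
          · have h7 := h3 i (by omega) (by omega)
            rw [if_neg (by omega), if_neg (by omega), if_neg (by omega),
                if_neg (by omega)] at h7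
            rw [h7, if_neg (by omega), if_neg (by omega)]
    · rw [if_neg (by omega)] at hk
      -- The letter `n + 1` moves one place to the right; being the greatest letter, it forms an
      -- inversion with its right neighbor.
      have hp : 1 ≤ q := by omega
      have ht := t_apply (i := q) (j := q + 1) (by omega) (by rw [abs_lt]; omega)
      refine main _ _ _ (q + 1) (Or.inr ⟨q, hp, by push_cast at *; omega, rfl⟩) (isSimple_t hp) ?_
        (by rw [ht, if_neg (by omega), if_pos rfl])
        (by rw [if_neg (by omega)]; push_cast at hk; omega) ?_
      · rw [hq]
        exact hlt _ (by rw [abs_of_pos] <;> push_cast at * <;> omega) (by omega)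
      · rintro π' ⟨h1, h2, h3⟩
        simp only [Equiv.Perm.mul_apply, ht, abs_of_pos (show 0 < q + 1 by omega)] at h1 h2 h3
        refine ⟨hq, fun i h4 h5 => ?_, fun i h4 h5 => ?_⟩ <;>
          rw [abs_of_pos (by omega)] at * <;> rw [if_neg (by omega)]
        · have h7 := h2 i h4 (by omega)
          rw [if_neg (by omega), if_neg (by omega), if_neg (by omega),
            if_neg (by omega), if_neg (by omega)] at h7
          exact h7
        · by_cases h6 : i = q
          · have h7 := h2 i (by omega) (by omega)
            rw [if_pos (by omega), if_neg (by omega)] at h7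
            rwa [h6] at h7 ⊢
          · have h7 := h3 i (by omega) (by omega)
            rw [if_neg (by omega), if_neg (by omega), if_neg (by omega),
              if_neg (by omega), if_neg (by omega)] at h7
            exact h7

theorem cost_nonneg {q j : ℤ} (h : |q| ≤ j) : 0 ≤ cost q j := by
  rw [abs_le] at h
  unfold cost
  split_ifs <;> omega

theorem exists_mul_prod {n : ℕ} (hn : 1 ≤ n) {π : Equiv.Perm ℤ} (hπ : π ∈ D (n + 1)) :
    ∃ π' ∈ D n, IsInsertion n π π' (π⁻¹ ((n : ℤ) + 1)) ∧
      ∃ L : List (Equiv.Perm ℤ), (∀ g ∈ L, g ∈ S (n + 1)) ∧ π = π' * L.prod ∧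
      (L.length : ℤ) = cost (π⁻¹ ((n : ℤ) + 1)) ((n : ℤ) + 1) ∧
      (inversions π).ncard = (inversions π').ncard + 2 * L.length := by
  obtain ⟨k, hk⟩ := Int.eq_ofNat_of_zero_le
    (cost_nonneg (abs_inv_apply_le hπ))
  obtain ⟨π', h1, h2, L, h3, h4, h5, h6⟩ := exists_mul_prod_aux hn k hπ (by simp) hk
  exact ⟨π', h1, h2, L, h3, h4, by rw [h5, hk], by rw [h5, h6]⟩

theorem exists_prod_eq {n : ℕ} (hn : 1 ≤ n) {π : Equiv.Perm ℤ} (hπ : π ∈ D n) :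
    ∃ L : List (Equiv.Perm ℤ), (∀ g ∈ L, g ∈ S n) ∧ L.prod = π ∧
      (inversions π).ncard = 2 * L.length := by
  induction n, hn using Nat.le_induction generalizing π with
  | base =>
    rw [eq_one_of_mem_D_one hπ]
    exact ⟨[], by simp, by simp, by simp [inversions_one]⟩
  | succ n hn ih =>
    obtain ⟨π', h1, -, L, h2, h3, -, h4⟩ := exists_mul_prod hn hπ
    obtain ⟨L', h5, h6, h7⟩ := ih h1
    refine ⟨L' ++ L, fun g hg => ?_, by rw [List.prod_append, h6, h3], ?_⟩
    · rcases List.mem_append.1 hg with hg | hg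
      · exact S_mono (Nat.le_succ n) (h5 g hg)
      · exact h2 g hg
    · rw [h4, h7, List.length_append]
      ring

theorem two_mul_len {n : ℕ} (hn : 1 ≤ n) {π : Equiv.Perm ℤ} (hπ : π ∈ D n) :
    2 * len n π = (inversions π).ncard := by
  obtain ⟨L, h1, rfl, h3⟩ := exists_prod_eq hn hπ
  rw [len_eq h1 h3, h3]

theorem closure_S {n : ℕ} (hn : 1 ≤ n) : Subgroup.closure (S n) = D n := by
  refine le_antisymm ((Subgroup.closure_le _).2 (S_subset_D n)) fun π hπ => ?_
  obtain ⟨L, h1, rfl, -⟩ := exists_prod_eq hn hπ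
  exact list_prod_mem fun g hg => Subgroup.subset_closure (h1 g hg)

/-! ### The C-code -/

theorem window_eq_map (n : ℕ) (π : Equiv.Perm ℤ) :
    window n π = (List.range n).map fun k : ℕ => π ((k : ℤ) + 1) := by
  simp [window, List.map_eq_flatMap, List.flatMap_assoc]

theorem cCode_succ {n : ℕ} (hn : 1 ≤ n) {π π' : Equiv.Perm ℤ} (hπ : π ∈ D (n + 1)) {q : ℤ}
    (h : IsInsertion n π π' q) :
    cCode (n + 1) π = Fin.snoc (α := fun _ => ℤ) (cCode n π') q := by
  obtain ⟨hq, hb, ha⟩ := h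
  have hq' : q = π⁻¹ ((n : ℤ) + 1) := by rw [Equiv.Perm.eq_inv_iff_eq, hq]
  have q0 : q ≠ 0 := hq' ▸ inv_apply_ne_zero hπ
  have q1 := abs_le.1 (hq' ▸ abs_inv_apply_le hπ : |q| ≤ (n : ℤ) + 1)
  have hlen : ∀ k σ, (window k σ).length = k := fun k σ => by simp [window_eq_map]
  have hget : ∀ k σ (i : ℕ) (hi : i < (window k σ).length), (window k σ)[i] = σ ((i : ℤ) + 1) :=
    fun k σ i hi => by simp [window_eq_map]
  have hnd : (window (n + 1) π).Nodup := by
    rw [window_eq_map]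
    refine List.Nodup.map (fun a b hab => ?_) List.nodup_range
    have := π.injective hab
    omega
  have hidx : ∀ (p : ℕ) (x : ℤ), p < n + 1 → π ((p : ℤ) + 1) = x →
      x ∈ window (n + 1) π ∧ (window (n + 1) π).idxOf x = p := fun p x hp hx => by
    have hp' : p < (window (n + 1) π).length := by rwa [hlen]
    have h1 := hget _ _ p hp'
    rw [hx] at h1
    rw [← h1]
    exact ⟨List.getElem_mem _, hnd.idxOf_getElem _ _⟩
  -- The sign of `q` decides which branch of the algorithm is taken.
  have hmem : (n : ℤ) + 1 ∈ window (n + 1) π → 0 < q := fun h => by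
    rw [window_eq_map] at h
    obtain ⟨i, -, h2⟩ := List.mem_map.1 h
    have := π.injective (h2.trans hq.symm)
    omega
  obtain ⟨k, rfl⟩ : ∃ k, n = k + 1 := ⟨n - 1, by omega⟩
  have hm : ((k + 1 : ℕ) : ℤ) + 1 = (k : ℤ) + 2 := by push_cast; ring
  rw [hm] at hq hq' q1 hmem
  rw [cCode, cCode, cCodeWord]
  rcases lt_or_gt_of_ne q0 with h0 | h0
  · rw [if_neg (fun h => absurd (hmem h) (by omega)), snoc_eq_snoc]
    obtain ⟨p, hp⟩ : ∃ p : ℕ, -q = (p : ℤ) + 1 := ⟨(-q - 1).toNat, by omega⟩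
    have hpq : |q| = (p : ℤ) + 1 := by rw [abs_of_neg h0, hp]
    obtain ⟨h1, h2⟩ := hidx p (-((k : ℤ) + 2)) (by omega) (by rw [← hp, hπ.1.1, hq])
    refine ⟨?_, by rw [h2]; omega⟩
    congr 1
    rw [List.erase_eq_eraseIdx_of_idxOf h2]
    have hneg : ∀ l : List ℤ, (negHead l).length = l.length := fun l => by
      cases l <;> simp [negHead]
    have hneg' : ∀ (l : List ℤ) (i : ℕ) (hi : i < l.length),
        (negHead l)[i]'(by rwa [hneg]) = if i = 0 then -l[i] else l[i] := fun l i hi => by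
      cases l with
      | nil => simp at hi
      | cons a l => cases i <;> simp [negHead]
    have hl : ((window (k + 1 + 1) π).eraseIdx p).length = k + 1 := by
      rw [List.length_eraseIdx, hlen, if_pos (by omega)]; omega
    refine List.ext_getElem (by rw [hneg, hl, hlen]) fun i hi1 hi2 => ?_
    rw [hneg, hl] at hi1
    rw [hneg' _ _ (by rwa [hl]), List.getElem_eraseIdx]
    simp only [hget]
    by_cases hip : i < p
    · have h3 := hb ((i : ℤ) + 1) (by omega) (by omega)
      rw [dif_pos hip, h3]
      split_ifs <;> omega
    · have h3 := ha ((i : ℤ) + 1) (by omega) (by omega)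
      rw [dif_neg hip]
      push_cast
      rw [h3]
      split_ifs <;> omega
  · obtain ⟨p, rfl⟩ : ∃ p : ℕ, q = (p : ℤ) + 1 := ⟨(q - 1).toNat, by omega⟩
    have hpq : |(p : ℤ) + 1| = (p : ℤ) + 1 := abs_of_pos h0
    obtain ⟨h1, h2⟩ := hidx p ((k : ℤ) + 2) (by omega) hq
    rw [if_pos h1, snoc_eq_snoc]
    refine ⟨?_, by rw [h2]⟩
    congr 1
    rw [List.erase_eq_eraseIdx_of_idxOf h2]
    have hl : ((window (k + 1 + 1) π).eraseIdx p).length = k + 1 := by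
      rw [List.length_eraseIdx, hlen, if_pos (by omega)]; omega
    refine List.ext_getElem (by rw [hl, hlen]) fun i hi1 hi2 => ?_
    rw [hl] at hi1
    rw [List.getElem_eraseIdx]
    simp only [hget]
    by_cases hip : i < p
    · have h3 := hb ((i : ℤ) + 1) (by omega) (by omega)
      rw [dif_pos hip, h3, if_neg (by omega)]
    · have h3 := ha ((i : ℤ) + 1) (by omega) (by omega)
      rw [dif_neg hip]
      push_cast
      rw [h3, if_neg (by omega)]

theorem IsInsertion.unique {n : ℕ} {π τ π' : Equiv.Perm ℤ} (hπ : π ∈ D (n + 1))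
    (hτ : τ ∈ D (n + 1)) {q : ℤ} (h1 : IsInsertion n π π' q) (h2 : IsInsertion n τ π' q) :
    π = τ := by
  have hpos : ∀ i, 1 ≤ i → i ≤ (n : ℤ) + 1 → π i = τ i := fun i hi hi' => by
    rcases lt_trichotomy i |q| with h | h | h
    · rw [h1.before i hi h, h2.before i hi h]
    · rw [h]
      rcases abs_choice q with hq | hq <;> rw [hq]
      · rw [h1.at_place, h2.at_place]
      · rw [hπ.1.1, hτ.1.1, h1.at_place, h2.at_place]
    · have h3 := h1.after (i - 1) (by omega) (by omega)
      have h4 := h2.after (i - 1) (by omega) (by omega)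
      rw [← h4, sub_add_cancel] at h3
      exact h3
  ext i
  rcases lt_or_ge ((n + 1 : ℕ) : ℤ) |i| with h | h
  · rw [hπ.1.2 i h, hτ.1.2 i h]
  · rw [abs_le] at h
    push_cast at h
    rcases lt_trichotomy i 0 with h3 | rfl | h3
    · have := hpos (-i) (by omega) (by omega)
      rw [hπ.1.1, hτ.1.1] at this
      omega
    · rw [hπ.1.map_zero, hτ.1.map_zero]
    · exact hpos i (by omega) (by omega)

theorem cCode_bijOn {n : ℕ} (hn : 1 ≤ n) : Set.BijOn (cCode n) (D n) (SE n) := by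
  have key : Set.MapsTo (cCode n) (D n) (SE n) ∧ Set.InjOn (cCode n) (D n) := by
    induction n, hn using Nat.le_induction with
    | base =>
      refine ⟨fun π hπ => ?_, fun π hπ τ hτ _ => ?_⟩
      · rw [eq_one_of_mem_D_one hπ]
        intro i
        simp [cCode, cCodeWord, window]
      · rw [eq_one_of_mem_D_one hπ, eq_one_of_mem_D_one hτ]
    | succ n hn ih =>
      refine ⟨fun π hπ => ?_, fun π hπ τ hτ h => ?_⟩
      · obtain ⟨π', h1, h2, -⟩ := exists_mul_prod hn hπ
        rw [cCode_succ hn hπ h2, snoc_mem_SE hn]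
        exact ⟨ih.1 h1, inv_apply_ne_zero hπ, abs_inv_apply_le hπ⟩
      · obtain ⟨π', h1, h2, -⟩ := exists_mul_prod hn hπ
        obtain ⟨τ', h3, h4, -⟩ := exists_mul_prod hn hτ
        rw [cCode_succ hn hπ h2, cCode_succ hn hτ h4, snoc_eq_snoc] at h
        rw [← h.2, ← ih.2 h1 h3 h.1] at h4
        exact h2.unique hπ hτ h4
  -- Surjectivity by counting: the D-code already shows that `SE n` is as large as `D n`.
  refine ⟨key.1, key.2, (Set.eq_of_subset_of_ncard_le key.1.image_subset ?_ (SE_finite n)).ge⟩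
  rw [key.2.ncard_image, ← (dCode_bijOn hn).image_eq, (dCode_bijOn hn).injOn.ncard_image]

/-! ### Statistics without colors -/

theorem mem_base {A : Set ℤ} {x : ℤ} : x ∈ base A ↔ 0 < x ∧ (x ∈ A ∨ -x ∈ A) := by
  simp only [base, color0, color1, Set.mem_union, Set.mem_ofPred_eq]
  tauto

theorem mem_base_Lmil {n : ℕ} {π : Equiv.Perm ℤ} (hπ : IsSigned n π) {x : ℤ} :
    x ∈ base (Lmil n π) ↔
      ∃ i : ℤ, 1 ≤ i ∧ i ≤ n ∧ (∀ j, 1 ≤ j → j < i → |π i| < |π j|) ∧ x = |π i| := by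
  rw [mem_base]
  constructor
  · rintro ⟨h0, ⟨i, h1, h2, h3, h4⟩ | ⟨i, h1, h2, h3, h4⟩⟩
    · exact ⟨i, h1, h2, h3, by rw [← h4, abs_of_pos h0]⟩
    · exact ⟨i, h1, h2, h3, by rw [← h4, abs_neg, abs_of_pos h0]⟩
  · rintro ⟨i, h1, h2, h3, rfl⟩
    refine ⟨abs_pos.2 (hπ.ne_zero (by omega)), ?_⟩
    rcases abs_choice (π i) with h | h
    · exact Or.inl ⟨i, h1, h2, h3, h⟩
    · exact Or.inr ⟨i, h1, h2, h3, by rw [h, neg_neg]⟩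

theorem mem_base_Lmap {n : ℕ} {π : Equiv.Perm ℤ} {x : ℤ} :
    x ∈ base (Lmap n π) ↔ 1 ≤ x ∧ x ≤ n ∧ ∀ j, 1 ≤ j → j < x → |π j| < |π x| := by
  rw [mem_base]
  constructor
  · rintro ⟨h0, ⟨i, h1, h2, h3, h4⟩ | ⟨i, h1, h2, h3, h4⟩⟩ <;>
    · have : x = i := by split_ifs at h4 <;> omega
      exact this ▸ ⟨h1, h2, h3⟩
  · rintro ⟨h1, h2, h3⟩
    refine ⟨by omega, ?_⟩
    by_cases h : π x < 0
    · exact Or.inr ⟨x, h1, h2, h3, by rw [if_pos h]⟩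
    · exact Or.inl ⟨x, h1, h2, h3, by rw [if_neg h]⟩

/-! ### Statistics of words under an insertion -/

/-- The place that the place `i` becomes after an insertion at the place `p`. -/
def shift (p i : ℤ) : ℤ := if i < p then i else i + 1

theorem shift_lt_shift {p i j : ℤ} : shift p i < shift p j ↔ i < j := by
  unfold shift
  split_ifs <;> omega

theorem exists_shift {n : ℕ} {p i : ℤ} (hp : 1 ≤ p ∧ p ≤ (n : ℤ) + 1)
    (hi : 1 ≤ i ∧ i ≤ (n : ℤ) + 1) (h : i ≠ p) : ∃ j : ℤ, (1 ≤ j ∧ j ≤ n) ∧ i = shift p j := by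
  unfold shift
  by_cases h1 : i < p
  · exact ⟨i, by omega, by rw [if_pos h1]⟩
  · exact ⟨i - 1, by omega, by rw [if_neg (by omega)]; omega⟩

theorem shift_mem {n : ℕ} {p i : ℤ} (hi : 1 ≤ i ∧ i ≤ n) :
    1 ≤ shift p i ∧ shift p i ≤ (n : ℤ) + 1 ∧ shift p i ≠ p := by
  unfold shift
  split_ifs <;> omega

section Insertion

variable {n : ℕ} {π π' : Equiv.Perm ℤ} {q : ℤ}

theorem IsInsertion.place_mem (hπ : π ∈ D (n + 1)) (h : IsInsertion n π π' q) :
    1 ≤ |q| ∧ |q| ≤ (n : ℤ) + 1 := by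
  have hq : q = π⁻¹ ((n : ℤ) + 1) := by rw [Equiv.Perm.eq_inv_iff_eq, h.at_place]
  have h1 := abs_pos.2 (hq ▸ inv_apply_ne_zero hπ : q ≠ 0)
  exact ⟨by omega, hq ▸ abs_inv_apply_le hπ⟩

theorem IsInsertion.abs_at_place (hπ : π ∈ D (n + 1)) (h : IsInsertion n π π' q) :
    |π (|q|)| = (n : ℤ) + 1 := by
  rw [hπ.1.abs_apply_abs, h.at_place, abs_of_pos (by omega)]

theorem IsInsertion.apply_shift (h : IsInsertion n π π' q) {i : ℤ} (hi : 1 ≤ i ∧ i ≤ n) :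
    π (shift |q| i) = if q < 0 ∧ i = 1 then -π' i else π' i := by
  unfold shift
  split_ifs with h1 h2
  · exact (h.before i hi.1 h1).trans (if_pos h2)
  · exact (h.before i hi.1 h1).trans (if_neg h2)
  · exact (h.after i (by omega) hi.2).trans (if_pos (by assumption))
  · exact (h.after i (by omega) hi.2).trans (if_neg (by assumption))

theorem IsInsertion.abs_apply_shift (h : IsInsertion n π π' q) {i : ℤ} (hi : 1 ≤ i ∧ i ≤ n) :
    |π (shift |q| i)| = |π' i| := by
  rw [h.apply_shift hi]
  split_ifs
  · rw [abs_neg]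
  · rfl

theorem IsSigned.abs_lt_succ (hπ : IsSigned n π) {i : ℤ} (hi : 1 ≤ i ∧ i ≤ n) :
    |π i| < (n : ℤ) + 1 := by
  have := hπ.abs_le (i := i) (by rw [_root_.abs_le]; omega)
  omega

theorem IsInsertion.mem_base_Lmil (hn : 1 ≤ n) (hπ : π ∈ D (n + 1)) (hπ' : π' ∈ D n)
    (h : IsInsertion n π π' q) {x : ℤ} :
    x ∈ base (Lmil (n + 1) π) ↔ x ∈ base (Lmil n π') ∨ x = (n : ℤ) + 1 ∧ |q| = 1 := by
  rw [EvenSigned.mem_base_Lmil hπ.1, EvenSigned.mem_base_Lmil hπ'.1]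
  push_cast
  have hp := h.place_mem hπ
  have hm := h.abs_at_place hπ
  constructor
  · rintro ⟨i, h1, h2, h3, rfl⟩
    by_cases hi : i = |q|
    · rw [hi, hm]
      refine Or.inr ⟨rfl, ?_⟩
      by_contra hq
      have h4 := h3 1 le_rfl (by omega)
      have h5 := hπ.1.abs_le (i := 1) (by rw [abs_one]; push_cast; omega)
      rw [hi, hm] at h4
      push_cast at h5
      omega
    · obtain ⟨i', h4, rfl⟩ := exists_shift hp ⟨h1, h2⟩ hi
      refine Or.inl ⟨i', h4.1, h4.2, fun j hj hj' => ?_, h.abs_apply_shift h4⟩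
      have h5 : 1 ≤ j ∧ j ≤ n := ⟨hj, by omega⟩
      have h6 := h3 (shift |q| j) (shift_mem h5).1 (shift_lt_shift.2 hj')
      rwa [h.abs_apply_shift h4, h.abs_apply_shift h5] at h6
  · rintro (⟨i, h1, h2, h3, rfl⟩ | ⟨rfl, h1⟩)
    · have h4 : 1 ≤ i ∧ i ≤ n := ⟨h1, h2⟩
      have h5 := shift_mem (p := |q|) h4
      refine ⟨shift |q| i, h5.1, h5.2.1, fun j hj hj' => ?_, (h.abs_apply_shift h4).symm⟩
      rw [h.abs_apply_shift h4]
      by_cases hjq : j = |q|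
      · rw [hjq, hm]
        exact hπ'.1.abs_lt_succ h4
      · obtain ⟨j, h6, rfl⟩ := exists_shift hp ⟨hj, by omega⟩ hjq
        rw [h.abs_apply_shift h6]
        exact h3 j h6.1 (shift_lt_shift.1 hj')
    · refine ⟨1, le_rfl, by omega, fun j _ _ => by omega, ?_⟩
      rw [← hm, h1]

/-- Places before the insertion keep their absolute values, and after the overall maximum there are
no further left-to-right maxima. -/
theorem IsInsertion.mem_base_Lmap (hπ : π ∈ D (n + 1)) (hπ' : π' ∈ D n)
    (h : IsInsertion n π π' q) {x : ℤ} :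
    x ∈ base (Lmap (n + 1) π) ↔ x ∈ base (Lmap n π') ∧ x < |q| ∨ x = |q| := by
  rw [EvenSigned.mem_base_Lmap, EvenSigned.mem_base_Lmap]
  push_cast
  have hp := h.place_mem hπ
  have hm := h.abs_at_place hπ
  have hlt : ∀ i, 1 ≤ i → i < |q| → |π i| = |π' i| := fun i h1 h2 => by
    have := h.abs_apply_shift (i := i) ⟨h1, by omega⟩
    rwa [shift, if_pos h2] at this
  constructor
  · rintro ⟨h1, h2, h3⟩
    rcases lt_trichotomy x |q| with hx | hx | hx
    · refine Or.inl ⟨⟨h1, by omega, fun j hj hj' => ?_⟩, hx⟩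
      rw [← hlt _ hj (by omega), ← hlt _ h1 hx]
      exact h3 j hj hj'
    · exact Or.inr hx
    · have h4 := h3 _ hp.1 hx
      have h5 := hπ.1.abs_le (i := x) (by rw [_root_.abs_le]; push_cast; omega)
      rw [hm] at h4
      push_cast at h5
      omega
  · rintro (⟨⟨h1, h2, h3⟩, hx⟩ | rfl)
    · refine ⟨h1, by omega, fun j hj hj' => ?_⟩
      rw [hlt _ hj (by omega), hlt _ h1 hx]
      exact h3 j hj hj'
    · refine ⟨hp.1, hp.2, fun j hj hj' => ?_⟩
      rw [hm, hlt j hj hj']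
      exact hπ'.1.abs_lt_succ ⟨hj, by omega⟩

/-- The letter `±1` occurs somewhere, and no first letter of larger absolute value can be smaller
than it. Hence a sign change of the first letter affects `Rmil` at `±1` only. -/
theorem abs_eq_one_of_Rmil_place_one (hn : 1 ≤ n) (hπ : IsSigned n π)
    (h : ∀ j : ℤ, 1 < j → j ≤ n → |π 1| < |π j|) : |π 1| = 1 := by
  have h1 := hπ.inv.abs_mem (i := 1) (by rw [Finset.mem_Icc]; omega)
  rw [Finset.mem_Icc] at h1
  have h2 : |π (|π⁻¹ 1|)| = 1 := by
    rw [hπ.abs_apply_abs]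
    simp
  have h3 := abs_pos.2 (hπ.ne_zero (i := 1) one_ne_zero)
  rcases eq_or_lt_of_le h1.1 with h4 | h4
  · rwa [← h4] at h2
  · have := h _ h4 h1.2
    omega

theorem IsInsertion.mem_Rmil (hn : 1 ≤ n) (hπ : π ∈ D (n + 1)) (hπ' : π' ∈ D n)
    (h : IsInsertion n π π' q) {x : ℤ} (hx : |x| ≠ 1) :
    x ∈ Rmil (n + 1) π ↔ x ∈ Rmil n π' ∨ x = q ∧ |q| = (n : ℤ) + 1 := by
  have hp := h.place_mem hπ
  have hm := h.abs_at_place hπ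
  constructor
  · rintro ⟨i, h1, h2, h3, rfl⟩
    push_cast at h2 h3
    by_cases hi : i = |q|
    · subst hi
      have hq : |q| = (n : ℤ) + 1 := by
        by_contra hq
        have h4 := h3 ((n : ℤ) + 1) (by omega) le_rfl
        have h5 := hπ.1.abs_le (i := (n : ℤ) + 1) (by rw [abs_of_pos] <;> push_cast <;> omega)
        rw [hm] at h4
        push_cast at h5
        omega
      refine Or.inr ⟨?_, hq⟩
      have h4 := h.at_place
      rcases abs_choice q with h5 | h5
      · rw [h5, h4]
        omega
      · rw [h5, hπ.1.1, h4]
        omega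
    · obtain ⟨i', h4, rfl⟩ := exists_shift hp ⟨h1, h2⟩ hi
      have h5 : ∀ j : ℤ, i' < j → j ≤ n → |π' i'| < |π' j| := fun j hj hj' => by
        have h5 : 1 ≤ j ∧ j ≤ n := ⟨by omega, hj'⟩
        have h6 := h3 (shift |q| j) (shift_lt_shift.2 hj) (shift_mem h5).2.1
        rwa [h.abs_apply_shift h4, h.abs_apply_shift h5] at h6
      refine Or.inl ⟨i', h4.1, h4.2, h5, ?_⟩
      rw [h.abs_apply_shift h4] at hx
      rw [h.apply_shift h4, if_neg]
      rintro ⟨-, rfl⟩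
      exact hx (abs_eq_one_of_Rmil_place_one hn hπ'.1 h5)
  · rintro (⟨i, h1, h2, h3, rfl⟩ | ⟨rfl, h1⟩)
    · have h4 : 1 ≤ i ∧ i ≤ n := ⟨h1, h2⟩
      have h5 := shift_mem (p := |q|) h4
      refine ⟨shift |q| i, h5.1, by push_cast; exact h5.2.1, fun j hj hj' => ?_, ?_⟩
      · push_cast at hj'
        rw [h.abs_apply_shift h4]
        by_cases hjq : j = |q|
        · rw [hjq, hm]
          exact hπ'.1.abs_lt_succ h4
        · obtain ⟨j, h6, rfl⟩ := exists_shift hp ⟨by omega, hj'⟩ hjq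
          rw [h.abs_apply_shift h6]
          exact h3 j (shift_lt_shift.1 hj) h6.2
      · rw [h.apply_shift h4, if_neg]
        rintro ⟨-, rfl⟩
        exact hx (abs_eq_one_of_Rmil_place_one hn hπ'.1 h3)
    · refine ⟨|x|, hp.1, by push_cast; exact hp.2, fun j hj hj' => ?_, ?_⟩
      · push_cast at hj'
        omega
      · have h4 := h.at_place
        rcases abs_choice x with h5 | h5
        · rw [h5, h4]
          omega
        · rw [h5, hπ.1.1, h4]
          omega

end Insertion

/-! ### Statistics under multiplication by a reflection -/

section Reflection

variable {n : ℕ} {σ : Equiv.Perm ℤ} {q : ℤ}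

theorem mul_t_apply_of_ne (h0 : q ≠ 0) (hq : |q| ≤ n) {i : ℤ}
    (hi : 1 ≤ i ∧ i ≤ n) (h : i ≠ |q|) : (σ * t q ((n : ℤ) + 1)) i = σ i := by
  have h1 := abs_pos.2 h0
  rw [Equiv.Perm.mul_apply, t_apply h0 (by omega)]
  rcases abs_choice q with h2 | h2 <;> rw [h2] at h <;>
    rw [if_neg (by omega), if_neg (by omega), if_neg (by omega), if_neg (by omega)]

theorem mul_t_apply_abs (hσ : σ ∈ D n) (h0 : q ≠ 0) (hq : |q| ≤ n) :
    (σ * t q ((n : ℤ) + 1)) (|q|) = if q < 0 then -((n : ℤ) + 1) else (n : ℤ) + 1 := by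
  have h := abs_pos.2 h0
  rw [Equiv.Perm.mul_apply, t_apply h0 (by omega)]
  split_ifs with h1 h2 h3 h4 h5 h6 h7 <;>
    first
    | exact fix_of_mem_D hσ
    | (rcases abs_choice q with h8 | h8 <;> omega)
    | (rw [hσ.1.1, fix_of_mem_D hσ])

theorem mul_t_apply_last (hσ : σ ∈ D n) (h0 : q ≠ 0) (hq : |q| ≤ n) :
    (σ * t q ((n : ℤ) + 1)) ((n : ℤ) + 1) = if q < 0 then -σ (|q|) else σ (|q|) := by
  have h1 := abs_lt.1 (show |q| < (n : ℤ) + 1 by omega)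
  rw [Equiv.Perm.mul_apply, t_apply h0 (by omega), if_neg (by omega), if_pos rfl]
  split_ifs with h
  · rw [abs_of_neg h, hσ.1.1, neg_neg]
  · rw [abs_of_pos (by omega)]

theorem mul_t_neg_apply (hn : 1 ≤ n) {i : ℤ} (hi : 1 < i ∧ i ≤ n) :
    (σ * t (-((n : ℤ) + 1)) ((n : ℤ) + 1)) i = σ i := by
  rw [Equiv.Perm.mul_apply, t_neg_apply (by omega), if_neg (by omega)]

theorem eq_or_eq_neg_of_not_le (hq : |q| ≤ (n : ℤ) + 1) (h : ¬|q| ≤ n) :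
    q = (n : ℤ) + 1 ∨ q = -((n : ℤ) + 1) := by
  rcases abs_choice q with h1 | h1 <;> omega

/-- Multiplication by a reflection changes the absolute values at the places `|q|` and `n + 1`
only. -/
theorem abs_mul_t_apply (hn : 1 ≤ n) (hσ : σ ∈ D n) (h0 : q ≠ 0) (hq : |q| ≤ (n : ℤ) + 1) :
    (∀ i : ℤ, 1 ≤ i ∧ i ≤ n → i ≠ |q| → |(σ * t q ((n : ℤ) + 1)) i| = |σ i|) ∧
    |(σ * t q ((n : ℤ) + 1)) (|q|)| = (n : ℤ) + 1 ∧
    |(σ * t q ((n : ℤ) + 1)) ((n : ℤ) + 1)| = |σ (|q|)| := by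
  have hm : |(n : ℤ) + 1| = (n : ℤ) + 1 := abs_of_pos (by omega)
  have hfix := fix_of_mem_D hσ
  by_cases h : |q| ≤ n
  · refine ⟨fun i hi hi' => by rw [mul_t_apply_of_ne h0 h hi hi'], ?_, ?_⟩
    · rw [mul_t_apply_abs hσ h0 h]
      split_ifs
      · rw [abs_neg, hm]
      · rw [hm]
    · rw [mul_t_apply_last hσ h0 h]
      split_ifs
      · rw [abs_neg]
      · rfl
  · rcases eq_or_eq_neg_of_not_le hq h with rfl | rfl
    · rw [t_self, mul_one, hm, hfix, hm]
      exact ⟨fun _ _ _ => rfl, rfl, rfl⟩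
    · rw [abs_neg, hm, hfix, hm, Equiv.Perm.mul_apply, t_neg_apply (by omega),
        if_pos (by simp), hσ.1.1, hfix, abs_neg, hm]
      refine ⟨fun i hi hi' => ?_, rfl, rfl⟩
      rw [Equiv.Perm.mul_apply, t_neg_apply (by omega)]
      split_ifs
      · rw [hσ.1.1, abs_neg]
      · rfl

theorem mul_t_mem_D_succ (hn : 1 ≤ n) (hσ : σ ∈ D n) (h0 : q ≠ 0) (hq : |q| ≤ (n : ℤ) + 1) :
    σ * t q ((n : ℤ) + 1) ∈ D (n + 1) :=
  mul_mem (D_mono (Nat.le_succ n) hσ) (t_mem_D hn h0 hq)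

theorem one_le_abs_of_ne_zero (h0 : q ≠ 0) : 1 ≤ |q| := by
  have := abs_pos.2 h0
  omega

theorem mem_base_Lmap_mul_t (hn : 1 ≤ n) (hσ : σ ∈ D n) (h0 : q ≠ 0)
    (hq : |q| ≤ (n : ℤ) + 1) {x : ℤ} :
    x ∈ base (Lmap (n + 1) (σ * t q ((n : ℤ) + 1))) ↔
      x ∈ base (Lmap n σ) ∧ x < |q| ∨ x = |q| := by
  rw [EvenSigned.mem_base_Lmap, EvenSigned.mem_base_Lmap]
  obtain ⟨hne, hp, -⟩ := abs_mul_t_apply hn hσ h0 hq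
  have hD := mul_t_mem_D_succ hn hσ h0 hq
  have hq1 := one_le_abs_of_ne_zero h0
  generalize σ * t q ((n : ℤ) + 1) = τ at *
  push_cast
  constructor
  · rintro ⟨h1, h2, h3⟩
    rcases lt_trichotomy x |q| with hx | hx | hx
    · refine Or.inl ⟨⟨h1, by omega, fun j hj hj' => ?_⟩, hx⟩
      have := h3 j hj hj'
      rwa [hne x (by omega) (by omega), hne j (by omega) (by omega)] at this
    · exact Or.inr hx
    · have h4 := h3 _ hq1 hx
      have h5 := hD.1.abs_le (i := x) (by rw [abs_le]; push_cast; omega)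
      rw [hp] at h4
      push_cast at h5
      omega
  · rintro (⟨⟨h1, h2, h3⟩, hx⟩ | rfl)
    · refine ⟨h1, by omega, fun j hj hj' => ?_⟩
      rw [hne x (by omega) (by omega), hne j (by omega) (by omega)]
      exact h3 j hj hj'
    · refine ⟨hq1, hq, fun j hj hj' => ?_⟩
      rw [hp, hne j (by omega) (by omega)]
      exact hσ.1.abs_lt_succ ⟨hj, by omega⟩

/-! ### Left-to-right minima of the word `π(1) π²(1) ⋯` -/

/-- The values of absolute value `z` that occur in `π(1) π²(1) ⋯` such that all values before
are greater than `x` in absolute value. -/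
inductive Reach (π : Equiv.Perm ℤ) (x : ℤ) : ℤ → Prop
  | start : Reach π x |π 1|
  | step {z : ℤ} : Reach π x z → x < z → Reach π x |π z|

theorem abs_pow_succ {π : Equiv.Perm ℤ} (hπ : IsSigned n π) (k : ℕ) (a : ℤ) :
    |(π ^ (k + 1)) a| = |π (|(π ^ k) a|)| := by
  rw [hπ.abs_apply_abs, pow_succ', Equiv.Perm.mul_apply]

theorem reach_iff {π : Equiv.Perm ℤ} (hπ : IsSigned n π) {x z : ℤ} :
    Reach π x z ↔
      ∃ k : ℕ, 1 ≤ k ∧ (∀ j : ℕ, 1 ≤ j → j < k → x < |(π ^ j) 1|) ∧ z = |(π ^ k) 1| := by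
  constructor
  · intro h
    induction h with
    | start => exact ⟨1, le_rfl, fun j _ _ => by omega, by rw [pow_one]⟩
    | step h hx ih =>
      obtain ⟨k, h1, h2, rfl⟩ := ih
      refine ⟨k + 1, by omega, fun j hj hj' => ?_, (abs_pow_succ hπ k 1).symm⟩
      rcases eq_or_lt_of_le (Nat.lt_succ_iff.1 hj') with rfl | h3
      · exact hx
      · exact h2 j hj h3
  · rintro ⟨k, h1, h2, rfl⟩
    induction k, h1 using Nat.le_induction with
    | base => rw [pow_one]; exact Reach.start
    | succ k hk ih =>
      rw [abs_pow_succ hπ]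
      exact (ih fun j hj hj' => h2 j hj (by omega)).step (h2 k hk (by omega))

theorem mem_base_Lmic {π : Equiv.Perm ℤ} (hπ : IsSigned n π) {x : ℤ} :
    x ∈ base (Lmic π) ↔ Reach π x x := by
  rw [mem_base, reach_iff hπ]
  constructor
  · rintro ⟨h0, ⟨k, h1, h2, h3⟩ | ⟨k, h1, h2, h3⟩⟩
    · have h4 : x = |(π ^ k) 1| := by rw [← h3, abs_of_pos h0]
      exact ⟨k, h1, h4 ▸ h2, h4⟩
    · have h4 : x = |(π ^ k) 1| := by rw [← h3, abs_neg, abs_of_pos h0]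
      exact ⟨k, h1, h4 ▸ h2, h4⟩
  · rintro ⟨k, h1, h2, h3⟩
    have hk : (π ^ k) 1 ≠ 0 := by
      have : ∀ k : ℕ, (π ^ k) 0 = 0 := fun k => by
        induction k with
        | zero => rfl
        | succ k ih => rw [pow_succ', Equiv.Perm.mul_apply, ih, hπ.map_zero]
      intro h
      exact one_ne_zero ((π ^ k).injective (h.trans (this k).symm))
    refine ⟨h3 ▸ abs_pos.2 hk, ?_⟩
    rw [h3] at h2
    rcases abs_choice ((π ^ k) 1) with h | h
    · exact Or.inl ⟨k, h1, h2, h3.trans h⟩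
    · exact Or.inr ⟨k, h1, h2, by rw [h3, h, neg_neg]⟩

theorem Reach.mem {π : Equiv.Perm ℤ} (hn : 1 ≤ n) (hπ : IsSigned n π) {x z : ℤ}
    (h : Reach π x z) : 1 ≤ z ∧ z ≤ n := by
  induction h with
  | start => simpa using hπ.abs_mem (i := 1) (by rw [Finset.mem_Icc]; omega)
  | step h hx ih => simpa using hπ.abs_mem (Finset.mem_Icc.2 ih)

/-- Up to signs, the multiplication inserts `n + 1` right after `|q|` in its cycle. The detour
through `n + 1` never blocks a path, as `n + 1 > x`. -/
theorem reach_mul_t (hn : 1 ≤ n) (hσ : σ ∈ D n) (h0 : q ≠ 0) (hq : |q| ≤ (n : ℤ) + 1)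
    {x z : ℤ} (hx : x ≤ n) (hz : z ≠ (n : ℤ) + 1) :
    Reach (σ * t q ((n : ℤ) + 1)) x z ↔ Reach σ x z := by
  obtain ⟨hne, hp, hm⟩ := abs_mul_t_apply hn hσ h0 hq
  generalize σ * t q ((n : ℤ) + 1) = τ at *
  constructor
  · intro h
    -- A path that stands at `n + 1` came from `|q|`. The case `|q| = 1` is separate because the
    -- word starts with the image of `1`, not with `1`.
    have key : ∀ z : ℤ, Reach τ x z →
        (z ≠ (n : ℤ) + 1 → Reach σ x z) ∧
        (z = (n : ℤ) + 1 → |q| = 1 ∨ Reach σ x |q| ∧ x < |q|) := by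
      intro z h
      induction h with
      | start =>
        by_cases h1 : |q| = 1
        · refine ⟨fun h => absurd ?_ h, fun _ => Or.inl h1⟩
          rw [← hp, h1]
        · rw [hne 1 (by omega) (Ne.symm h1)]
          refine ⟨fun _ => Reach.start, fun h => ?_⟩
          have := hσ.1.abs_lt_succ (i := 1) (by omega)
          omega
      | @step z h hx ih =>
        by_cases hzm : z = (n : ℤ) + 1
        · subst hzm
          rw [hm]
          rcases ih.2 rfl with h1 | ⟨h1, h2⟩
          · rw [h1]
            refine ⟨fun _ => Reach.start, fun h => ?_⟩
            have := hσ.1.abs_lt_succ (i := 1) (by omega)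
            omega
          · refine ⟨fun _ => h1.step h2, fun h => ?_⟩
            have := hσ.1.abs_lt_succ (h1.mem hn hσ.1)
            omega
        · have h1 := ih.1 hzm
          have h2 := h1.mem hn hσ.1
          by_cases hzq : z = |q|
          · rw [hzq, hp]
            exact ⟨fun h => absurd rfl h, fun _ => Or.inr (hzq ▸ ⟨h1, hx⟩)⟩
          · rw [hne z h2 hzq]
            refine ⟨fun _ => h1.step hx, fun h => ?_⟩
            have := hσ.1.abs_lt_succ h2
            omega
    exact (key z h).1 hz
  · intro h
    clear hz
    have hlast : ∀ y, |q| = y → Reach τ x ((n : ℤ) + 1) →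
        Reach τ x |σ y| := by
      rintro y rfl h
      rw [← hm]
      exact h.step (by omega)
    induction h with
    | start =>
      by_cases h1 : |q| = 1
      · refine hlast 1 h1 ?_
        rw [← hp, h1]
        exact Reach.start
      · rw [← hne 1 (by omega) (Ne.symm h1)]
        exact Reach.start
    | @step z h hx ih =>
      by_cases hzq : z = |q|
      · refine hlast z hzq.symm ?_
        rw [← hp, ← hzq]
        exact ih.step hx
      · rw [← hne z (h.mem hn hσ.1) hzq]
        exact ih.step hx

theorem mem_base_Lmic_mul_t (hn : 1 ≤ n) (hσ : σ ∈ D n) (h0 : q ≠ 0)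
    (hq : |q| ≤ (n : ℤ) + 1) {x : ℤ} :
    x ∈ base (Lmic (σ * t q ((n : ℤ) + 1))) ↔
      x ∈ base (Lmic σ) ∨ x = (n : ℤ) + 1 ∧ |q| = 1 := by
  have hD := mul_t_mem_D_succ hn hσ h0 hq
  rw [mem_base_Lmic hσ.1, mem_base_Lmic hD.1]
  obtain ⟨hne, hp, -⟩ := abs_mul_t_apply hn hσ h0 hq
  have hreach := reach_mul_t hn hσ h0 hq (x := x) (z := x)
  generalize σ * t q ((n : ℤ) + 1) = τ at *
  rcases lt_trichotomy x ((n : ℤ) + 1) with hx | rfl | hx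
  · rw [hreach (by omega) hx.ne]
    constructor
    · exact Or.inl
    · rintro (h | h)
      · exact h
      · omega
  · constructor
    · intro h
      refine Or.inr ⟨rfl, ?_⟩
      -- If `|q| ≠ 1`, the first letter of the word is smaller than `n + 1` in absolute value, so `n
      -- + 1` is not a left-to-right minimum.
      by_contra h1
      have h2 : |τ 1| < (n : ℤ) + 1 := by
        rw [hne 1 (by omega) (Ne.symm h1)]
        exact hσ.1.abs_lt_succ (by omega)
      obtain ⟨k, h3, h4, h5⟩ := (reach_iff hD.1).1 h
      rcases eq_or_lt_of_le h3 with rfl | h3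
      · rw [pow_one] at h5
        omega
      · have := h4 1 le_rfl h3
        rw [pow_one] at this
        omega
    · rintro (h | ⟨-, h⟩)
      · have := h.mem hn hσ.1
        omega
      · have h1 : Reach τ ((n : ℤ) + 1)
            |τ 1| := Reach.start
        rw [h] at hp
        rwa [hp] at h1
  · constructor
    · intro h
      have := h.mem (by omega) hD.1
      push_cast at this
      omega
    · rintro (h | h)
      · have := h.mem hn hσ.1
        omega
      · omega

/-! ### Cycles -/

theorem mem_cycle_self {π : Equiv.Perm ℤ} {a : ℤ} (ha : 1 ≤ a) : a ∈ cycle π a :=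
  ⟨0, by simp [abs_of_pos (show 0 < a by omega)]⟩

theorem apply_mem_cycle {π : Equiv.Perm ℤ} (hπ : IsSigned n π) {a i : ℤ} (h : i ∈ cycle π a) :
    |π i| ∈ cycle π a := by
  obtain ⟨k, rfl⟩ := h
  exact ⟨k + 1, (abs_pow_succ hπ k a).symm⟩

theorem cycle_subset {π : Equiv.Perm ℤ} (hπ : IsSigned n π) {a : ℤ} (ha : 1 ≤ a) {T : Set ℤ}
    (h : a ∈ T) (hT : ∀ i ∈ T, |π i| ∈ T) : cycle π a ⊆ T := by
  rintro _ ⟨k, rfl⟩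
  induction k with
  | zero => simpa [abs_of_pos (show 0 < a by omega)] using h
  | succ k ih =>
    rw [abs_pow_succ hπ]
    exact hT _ ih

theorem cycle_subset_Icc {π : Equiv.Perm ℤ} (hπ : IsSigned n π) {a : ℤ}
    (ha : 1 ≤ a ∧ a ≤ n) : cycle π a ⊆ Finset.Icc (1 : ℤ) n :=
  cycle_subset hπ ha.1 (by simpa using ha) fun _ hi => hπ.abs_mem hi

/-- The new element `n + 1` joins the cycle of `|q|`, and all cycles of smaller elements are
otherwise unchanged. Each inclusion holds because the other side is stable under the map. -/
theorem mem_cycle_mul_t (hn : 1 ≤ n) (hσ : σ ∈ D n) (h0 : q ≠ 0) (hq : |q| ≤ (n : ℤ) + 1)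
    {a : ℤ} (ha : 1 ≤ a ∧ a ≤ n) {x : ℤ} :
    x ∈ cycle (σ * t q ((n : ℤ) + 1)) a ↔
      x ∈ cycle σ a ∨ x = (n : ℤ) + 1 ∧ |q| ∈ cycle σ a := by
  have hD := mul_t_mem_D_succ hn hσ h0 hq
  obtain ⟨hne, hp, hm⟩ := abs_mul_t_apply hn hσ h0 hq
  generalize σ * t q ((n : ℤ) + 1) = τ at *
  have hI : ∀ i ∈ cycle σ a, 1 ≤ i ∧ i ≤ n := fun i hi => by
    simpa using cycle_subset_Icc hσ.1 ha hi
  have hsub : cycle σ a ⊆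
      {i | (1 ≤ i ∧ i ≤ n) ∧ i ∈ cycle τ a} := by
    refine cycle_subset hσ.1 ha.1 ⟨ha, mem_cycle_self ha.1⟩ ?_
    rintro i ⟨hi, hi'⟩
    refine ⟨by simpa using hσ.1.abs_mem (Finset.mem_Icc.2 hi), ?_⟩
    have h1 := apply_mem_cycle hD.1 hi'
    by_cases hiq : i = |q|
    · rw [hiq, hp] at h1
      have h2 := apply_mem_cycle hD.1 h1
      rwa [hm, ← hiq] at h2
    · rwa [hne i hi hiq] at h1
  constructor
  · refine fun h => cycle_subset hD.1 ha.1
      (T := {x | x ∈ cycle σ a ∨ x = (n : ℤ) + 1 ∧ |q| ∈ cycle σ a})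
      (Or.inl (mem_cycle_self ha.1)) ?_ h
    rintro i (hi | ⟨rfl, hi⟩)
    · by_cases hiq : i = |q|
      · rw [hiq, hp]
        exact Or.inr ⟨rfl, hiq ▸ hi⟩
      · rw [hne i (hI i hi) hiq]
        exact Or.inl (apply_mem_cycle hσ.1 hi)
    · rw [hm]
      exact Or.inl (apply_mem_cycle hσ.1 hi)
  · rintro (h | ⟨rfl, h⟩)
    · exact (hsub h).2
    · rw [← hp]
      exact apply_mem_cycle hD.1 (hsub h).2

open Classical in
theorem neg_one_pow_ncard {N : ℕ} {C : Set ℤ} (hC : C ⊆ Finset.Icc (1 : ℤ) N)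
    (π : Equiv.Perm ℤ) : (-1 : ℤ) ^ ({i ∈ C | π i < 0}).ncard =
      ∏ i ∈ Finset.Icc (1 : ℤ) N, if i ∈ C ∧ π i < 0 then -1 else 1 := by
  have h : {i ∈ C | π i < 0} =
      ((Finset.Icc (1 : ℤ) N).filter fun i => i ∈ C ∧ π i < 0 : Finset ℤ) := by
    ext i
    rw [Finset.coe_filter]
    exact ⟨fun h => ⟨hC h.1, h⟩, fun h => h.2⟩
  rw [h, Set.ncard_coe_finset, ← Finset.prod_const, Finset.prod_filter]

open Classical in
-- Only the cycle of `1` can change its color, because `t (-j) j` also changes the sign at the place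
-- `1`.
theorem neg_one_pow_ncard_mul_t (hn : 1 ≤ n) (hσ : σ ∈ D n) (h0 : q ≠ 0)
    (hq : |q| ≤ (n : ℤ) + 1) {a : ℤ} (ha : 1 ≤ a ∧ a ≤ n) (h1 : 1 ∉ cycle σ a) :
    (-1 : ℤ) ^ ({i ∈ cycle (σ * t q ((n : ℤ) + 1)) a |
        (σ * t q ((n : ℤ) + 1)) i < 0}).ncard =
      (-1) ^ ({i ∈ cycle σ a | σ i < 0}).ncard := by
  have hI : ∀ i ∈ cycle σ a, 1 ≤ i ∧ i ≤ n := fun i hi => by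
    simpa using cycle_subset_Icc hσ.1 ha hi
  have hD := mul_t_mem_D_succ hn hσ h0 hq
  have hcyc := fun x => mem_cycle_mul_t hn hσ h0 hq ha (x := x)
  by_cases hqc : |q| ∈ cycle σ a
  · have hqn := hI _ hqc
    rw [neg_one_pow_ncard (cycle_subset_Icc hσ.1 ha),
      neg_one_pow_ncard (cycle_subset_Icc hD.1 (by push_cast; omega))]
    have hins : Finset.Icc (1 : ℤ) ((n + 1 : ℕ) : ℤ) =
        insert ((n : ℤ) + 1) (Finset.Icc (1 : ℤ) n) := by
      ext i
      simp only [Finset.mem_Icc, Finset.mem_insert]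
      push_cast
      omega
    rw [hins, Finset.prod_insert (by simp),
      ← Finset.mul_prod_erase _ _ (Finset.mem_Icc.2 hqn), ← mul_assoc,
      ← Finset.mul_prod_erase (Finset.Icc (1 : ℤ) n)
        (fun i => if i ∈ cycle σ a ∧ σ i < 0 then (-1 : ℤ) else 1) (Finset.mem_Icc.2 hqn)]
    -- For `q < 0` the letter at `|q|` becomes negative and the one moved to `n + 1` is negated; for
    -- `q > 0` the former is positive and the latter keeps its sign. In both cases the product of
    -- the two signs is the old sign at `|q|`.
    congr 1
    · have hz := hσ.1.ne_zero (i := |q|) (by omega)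
      simp only [hcyc, hqc, true_or, and_true, or_true, true_and,
        mul_t_apply_abs hσ h0 hqn.2, mul_t_apply_last hσ h0 hqn.2]
      split_ifs <;> omega
    · refine Finset.prod_congr rfl fun i hi => ?_
      rw [Finset.mem_erase, Finset.mem_Icc] at hi
      rw [hcyc, mul_t_apply_of_ne h0 hqn.2 hi.2 hi.1]
      have : ¬(i = (n : ℤ) + 1 ∧ |q| ∈ cycle σ a) := by omega
      simp only [this, or_false]
  · congr 2
    ext i
    have hi : i ∈ cycle (σ * t q ((n : ℤ) + 1)) a ↔ i ∈ cycle σ a := (hcyc i).trans (by simp [hqc])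
    refine (and_congr_left' hi).trans (and_congr_right fun hi => ?_)
    have hi' := hI i hi
    have hi1 : i ≠ 1 := fun h => h1 (h ▸ hi)
    by_cases h : |q| ≤ n
    · rw [mul_t_apply_of_ne h0 h hi' fun h => hqc (h ▸ hi)]
    · rcases eq_or_eq_neg_of_not_le hq h with rfl | rfl
      · rw [t_self, mul_one]
      · rw [mul_t_neg_apply hn (by omega)]

theorem mem_Cyc_mul_t (hn : 1 ≤ n) (hσ : σ ∈ D n) (h0 : q ≠ 0) (hq : |q| ≤ (n : ℤ) + 1)
    {x : ℤ} (hx : |x| ≠ 1) :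
    x ∈ Cyc (n + 1) (σ * t q ((n : ℤ) + 1)) ↔ x ∈ Cyc n σ ∨ x = q ∧ |q| = (n : ℤ) + 1 := by
  have hD := mul_t_mem_D_succ hn hσ h0 hq
  obtain ⟨-, hp, hm⟩ := abs_mul_t_apply hn hσ h0 hq
  -- the cycle of `n + 1` is a singleton if `|q| = n + 1`
  have hlast : |q| = (n : ℤ) + 1 →
      (-1) ^ ({i ∈ cycle (σ * t q ((n : ℤ) + 1)) ((n : ℤ) + 1) |
        (σ * t q ((n : ℤ) + 1)) i < 0}).ncard * ((n : ℤ) + 1) = q ∧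
      ∀ i ∈ cycle (σ * t q ((n : ℤ) + 1)) ((n : ℤ) + 1), (n : ℤ) + 1 ≤ i := by
    intro h
    have hcyc : cycle (σ * t q ((n : ℤ) + 1)) ((n : ℤ) + 1) = {(n : ℤ) + 1} := by
      have h1 : 1 ≤ (n : ℤ) + 1 := by omega
      refine (cycle_subset hD.1 h1 (T := {(n : ℤ) + 1}) rfl ?_).antisymm
        (Set.singleton_subset_iff.2 (mem_cycle_self h1))
      rintro i rfl
      rw [h] at hp
      exact hp
    refine ⟨?_, by rw [hcyc]; rintro i rfl; exact le_rfl⟩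
    rw [hcyc]
    rcases abs_choice q with h1 | h1
    · have hq' : q = (n : ℤ) + 1 := by omega
      have : {i ∈ ({(n : ℤ) + 1} : Set ℤ) | (σ * t q ((n : ℤ) + 1)) i < 0} = ∅ := by
        rw [Set.eq_empty_iff_forall_notMem]
        rintro i ⟨rfl, hi⟩
        rw [hq', t_self, mul_one, fix_of_mem_D hσ] at hi
        omega
      rw [this, Set.ncard_empty, pow_zero, one_mul, hq']
    · have hq' : q = -((n : ℤ) + 1) := by omega
      have : {i ∈ ({(n : ℤ) + 1} : Set ℤ) | (σ * t q ((n : ℤ) + 1)) i < 0} =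
          {(n : ℤ) + 1} := by
        refine Set.Subset.antisymm (fun i hi => hi.1) ?_
        rintro i rfl
        refine ⟨rfl, ?_⟩
        rw [hq', Equiv.Perm.mul_apply, t_neg_apply (by omega), if_pos (by simp), hσ.1.1,
          fix_of_mem_D hσ]
        omega
      rw [this, Set.ncard_singleton, pow_one, hq', neg_one_mul]
  have hmin : ∀ a : ℤ, 1 ≤ a ∧ a ≤ n →
      ((∀ i ∈ cycle (σ * t q ((n : ℤ) + 1)) a, a ≤ i) ↔ ∀ i ∈ cycle σ a, a ≤ i) := by
    intro a ha
    refine ⟨fun h i hi => h i ((mem_cycle_mul_t hn hσ h0 hq ha).2 (Or.inl hi)), fun h i hi => ?_⟩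
    rcases (mem_cycle_mul_t hn hσ h0 hq ha).1 hi with hi | ⟨hi, -⟩
    · exact h i hi
    · omega
  have hpar : ∀ a : ℤ, 1 < a ∧ a ≤ n → (∀ i ∈ cycle σ a, a ≤ i) →
      (-1 : ℤ) ^ ({i ∈ cycle (σ * t q ((n : ℤ) + 1)) a |
        (σ * t q ((n : ℤ) + 1)) i < 0}).ncard =
      (-1) ^ ({i ∈ cycle σ a | σ i < 0}).ncard := fun a ha h =>
    neg_one_pow_ncard_mul_t hn hσ h0 hq (by omega) fun h1 => by
      have := h 1 h1
      omega
  -- As `x ≠ ±1`, the cycle of `1` never has to be considered.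
  have hne : ∀ (k : ℕ) (a : ℤ), x = (-1) ^ k * a → a ≠ 1 := by
    rintro k a rfl rfl
    exact hx (by simp)
  constructor
  · rintro ⟨a, h1, h2, h3, h4⟩
    push_cast at h2
    have ha1 := hne _ _ h4
    by_cases ha : a = (n : ℤ) + 1
    · subst ha
      have hqn : |q| = (n : ℤ) + 1 := by
        by_contra hqn
        have h5 := h3 _ (apply_mem_cycle hD.1 (mem_cycle_self h1))
        rw [hm] at h5
        have h6 := hσ.1.abs_lt_succ (i := |q|) ⟨one_le_abs_of_ne_zero h0, by omega⟩
        omega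
      exact Or.inr ⟨h4.trans (hlast hqn).1, hqn⟩
    · have h5 := (hmin a ⟨h1, by omega⟩).1 h3
      refine Or.inl ⟨a, h1, by omega, h5, ?_⟩
      rw [h4, hpar a (by omega) h5]
  · rintro (⟨a, h1, h2, h3, h4⟩ | ⟨rfl, hqn⟩)
    · have ha1 := hne _ _ h4
      refine ⟨a, h1, by push_cast; omega, (hmin a ⟨h1, h2⟩).2 h3, ?_⟩
      rw [h4, hpar a (by omega) h3]
    · exact ⟨(n : ℤ) + 1, by omega, by push_cast; exact le_rfl, (hlast hqn).2,
        (hlast hqn).1.symm⟩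

end Reflection

/-! ### The comparison of the two codes -/

/-- Permutations with corresponding codes have the same statistics. -/
theorem statistics_eq {n : ℕ} (hn : 1 ≤ n) {π σ : Equiv.Perm ℤ} (hπ : π ∈ D n) (hσ : σ ∈ D n)
    (h : cCode n π = dCode n σ) :
    (len n π : ℤ) = sor n σ ∧ (∀ x : ℤ, |x| ≠ 1 → (x ∈ Rmil n π ↔ x ∈ Cyc n σ)) ∧
      base (Lmil n π) = base (Lmic σ) ∧ base (Lmap n π) = base (Lmap n σ) := by
  induction n, hn using Nat.le_induction generalizing π σ with
  | base =>
    rw [eq_one_of_mem_D_one hπ, eq_one_of_mem_D_one hσ]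
    refine ⟨?_, fun x hx => ?_, ?_, rfl⟩
    · have := two_mul_len le_rfl (one_mem (D 1))
      rw [inversions_one, Set.ncard_empty] at this
      rw [sor_one]
      omega
    · constructor
      · rintro ⟨i, h1, h2, -, h3⟩
        push_cast at h2
        obtain rfl : i = 1 := by omega
        exact absurd (by simp [h3]) hx
      · rintro ⟨a, h1, h2, -, rfl⟩
        push_cast at h2
        obtain rfl : a = 1 := by omega
        exact absurd (by simp) hx
    · ext x
      rw [mem_base_Lmil (one_mem (D 1)).1, mem_base_Lmic (one_mem (D 1)).1,
        reach_iff (one_mem (D 1)).1]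
      constructor
      · rintro ⟨i, h1, h2, -, rfl⟩
        push_cast at h2
        obtain rfl : i = 1 := by omega
        exact ⟨1, le_rfl, fun j _ _ => by omega, by simp⟩
      · rintro ⟨k, -, -, rfl⟩
        exact ⟨1, le_rfl, by simp, fun j _ _ => by omega, by simp⟩
  | succ n hn ih =>
    obtain ⟨π', h1, h2, L, -, -, h3, h4⟩ := exists_mul_prod hn hπ
    rw [cCode_succ hn hπ h2, dCode_succ hn, snoc_eq_snoc] at h
    -- Equal codes have equal last entries, so both sides are built with the same `q`.
    rw [h.2] at h2 h3 h
    have h5 := mul_t_mem_D hn hσ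
    have h0 := inv_apply_ne_zero hσ
    have hq := abs_inv_apply_le hσ
    generalize σ⁻¹ ((n : ℤ) + 1) = q at *
    have h6 : σ = σ * t q ((n : ℤ) + 1) * t q ((n : ℤ) + 1) := by
      rw [mul_assoc, t_mul_self (by omega) h0 hq, mul_one]
    generalize σ * t q ((n : ℤ) + 1) = σ' at *
    subst h6
    obtain ⟨i1, i2, i3, i4⟩ := ih h1 h5 h.1
    refine ⟨?_, fun x hx => ?_, ?_, ?_⟩
    · rw [sor_mul_t hn h5 h0 hq]
      have := two_mul_len (by omega) hπ
      have := two_mul_len hn h1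
      omega
    · rw [h2.mem_Rmil hn hπ h1 hx, mem_Cyc_mul_t hn h5 h0 hq hx, i2 x hx]
    · ext x
      rw [h2.mem_base_Lmil hn hπ h1, mem_base_Lmic_mul_t hn h5 h0 hq, i3]
    · ext x
      rw [h2.mem_base_Lmap hπ h1, mem_base_Lmap_mul_t hn h5 h0 hq, i4]

theorem color0_union_one {A B : Set ℤ} (h : ∀ x : ℤ, |x| ≠ 1 → (x ∈ A ↔ x ∈ B)) :
    color0 A ∪ {1} = color0 B ∪ {1} := by
  ext x
  by_cases hx : x = 1
  · simp [hx]
  · simp only [color0, Set.mem_union, Set.mem_singleton_iff, hx, or_false]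
    exact and_congr_right fun h0 => h x (by rwa [abs_of_pos h0])

theorem color1_sdiff_one {A B : Set ℤ} (h : ∀ x : ℤ, |x| ≠ 1 → (x ∈ A ↔ x ∈ B)) :
    color1 A \ {1} = color1 B \ {1} := by
  ext x
  by_cases hx : x = 1
  · simp [hx]
  · simp only [color1, Set.mem_sdiff, Set.mem_singleton_iff, hx, not_false_eq_true, and_true]
    exact and_congr_right fun h0 => h (-x) (by rwa [abs_neg, abs_of_pos h0])

end EvenSigned

theorem theorem6p1 (n : ℕ) (hn : 1 ≤ n) :
    -- `ℓ_D`, `sor_D` and `ψ` are well defined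
    Subgroup.closure (EvenSigned.S n) = EvenSigned.D n ∧
    (∀ π ∈ EvenSigned.D n, ∃! L, EvenSigned.IsFactorization n π L) ∧
    Set.BijOn (EvenSigned.cCode n) (EvenSigned.D n) (EvenSigned.SE n) ∧
    Set.BijOn (EvenSigned.dCode n) (EvenSigned.D n) (EvenSigned.SE n) ∧
    -- the equality of the two tuples
    ∀ π ∈ EvenSigned.D n,
      ((EvenSigned.len n π : ℤ), EvenSigned.RmilPlus n π, EvenSigned.RmilMinus n π,
        EvenSigned.base (EvenSigned.Lmil n π), EvenSigned.base (EvenSigned.Lmap n π)) =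
      (EvenSigned.sor n (EvenSigned.psi n π), EvenSigned.CycPlus n (EvenSigned.psi n π),
        EvenSigned.CycMinus n (EvenSigned.psi n π),
        EvenSigned.base (EvenSigned.Lmic (EvenSigned.psi n π)),
        EvenSigned.base (EvenSigned.Lmap n (EvenSigned.psi n π))) := by
  refine ⟨EvenSigned.closure_S hn, fun π hπ => EvenSigned.existsUnique_isFactorization hn hπ,
    EvenSigned.cCode_bijOn hn, EvenSigned.dCode_bijOn hn, fun π hπ => ?_⟩
  -- The C-code of `π` is a D-code, so `psi` does not take the default value of `Function.invFunOn`.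
  have hmem : EvenSigned.cCode n π ∈ EvenSigned.dCode n '' EvenSigned.D n :=
    (EvenSigned.dCode_bijOn hn).surjOn ((EvenSigned.cCode_bijOn hn).mapsTo hπ)
  have hψ : EvenSigned.psi n π ∈ EvenSigned.D n := Function.invFunOn_mem hmem
  obtain ⟨h1, h2, h3, h4⟩ := EvenSigned.statistics_eq hn hπ hψ
    (Function.invFunOn_eq hmem).symm
  rw [h1, h3, h4, EvenSigned.RmilPlus, EvenSigned.RmilMinus, EvenSigned.color0_union_one h2,
    EvenSigned.color1_sdiff_one h2]
  rfl
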